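/- Conventions. Surfaces are compact 2-manifolds without boundary; $S_h$ ($h\ge 0$) and $N_k$ ($k\ge 1$) denote the connected orientable surface of genus $h$ and the connected nonorientable surface of genus $k$, so $\chi(S_h)=2-2h$ and $\chi(N_k)=2-k$. Embeddings of graphs in surfaces are cellular (every face is an open disk). An embedding is orientable or nonorientable according to its surface, and it is quadrangular, or a quadrangulation of the surface, if every face is bounded by a $4$-cycle. A quadrangulation of a surface $\Sigma$ is minimal if its underlying graph is simple and connected, and no simple graph of smaller order has a quadrangular embedding in $\Sigma$. For simple graphs $G$ and $H$, the composition (lexicographic product) $G[H]$ has vertex set $V(G)\times V(H)$, with $(v_1,u_1)$ and $(v_2,u_2)$ adjacent if and only if $v_1v_2\in E(G)$, or $v_1=v_2$ and $u_1u_2\in E(H)$. Statement. Let $\ell$ and $q$ be integers with $\ell\ge 1$ and $0\le q\le(\ell-1)/2$. If $G$ is obtained from $K_{2\ell}$ by deleting at most $q$ edges, then $G[K_4]$ has both an orientable and a nonorientable quadrangular embedding, each of which is minimal. Moreover, the orientable surface of genus $8\ell^2-5\ell-4q+1$ and the nonorientable surface of genus $16\ell^2-10\ell-8q+2$ have minimal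 quadrangulations, and all minimal quadrangulations of these two surfaces have order $8\ell$. -/

import Mathlib

/-- The composition (lexicographic product) `G[H]`: its vertices are the pairs `(v, u)`, and
`(v₁, u₁)`, `(v₂, u₂)` are adjacent iff `v₁v₂ ∈ E(G)`, or `v₁ = v₂` and `u₁u₂ ∈ E(H)`. -/
def SimpleGraph.composition {V W : Type*} (G : SimpleGraph V) (H : SimpleGraph W) :
    SimpleGraph (V × W) where
  Adj x y := G.Adj x.1 y.1 ∨ (x.1 = y.1 ∧ H.Adj x.2 y.2)
  symm := ⟨fun _ _ h => h.elim (fun h => Or.inl h.symm) fun h => Or.inr ⟨h.1.symm, h.2.symm⟩⟩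
  loopless := ⟨fun _ h => h.elim (fun h => h.ne rfl) fun h => h.2.ne rfl⟩

/-- A cellular embedding of the simple graph `G` in a surface (a compact 2-manifold without
boundary), described by a rotation and edge signatures. A dart is an edge with a direction, and
belongs to its initial vertex `d.fst`.
* `rot` sends a dart to the next one around its initial vertex, with respect to a chosen local
  orientation there; the darts at each vertex form one cycle.
* `sig` is the signature of an edge: `1` if the local orientations at the two ends agree along
  the edge, and `-1` if they disagree. -/
structure CellularEmbedding {V : Type*} (G : SimpleGraph V) where
  rot : Equiv.Perm G.Dart
  rot_fst : ∀ d : G.Dart, (rot d).fst = d.fst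
  rot_cyclic : ∀ d d' : G.Dart, d.fst = d'.fst → rot.SameCycle d d'
  sig : G.Dart → ℤˣ
  sig_symm : ∀ d : G.Dart, sig d.symm = sig d

namespace CellularEmbedding

variable {V : Type*} {G : SimpleGraph V} (Φ : CellularEmbedding G)

/-- A flag `(d, ε)` is a dart `d` together with one of the two sides of its edge: the side towards
`rot d` if `ε = 1`, and the side towards `rot⁻¹ d` if `ε = -1`, as seen near `d.fst`. -/
abbrev Flag (_ : CellularEmbedding G) : Type _ := G.Dart × ℤˣ

/-- Go to the other end of the edge, staying on the same side of it. -/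
def along (f : Φ.Flag) : Φ.Flag := (f.1.symm, -(f.2 * Φ.sig f.1))

/-- Turn the corner at the initial vertex, inside the face on whose boundary the flag lies. -/
def turn (f : Φ.Flag) : Φ.Flag := ((Φ.rot ^ (f.2 : ℤ)) f.1, -f.2)

/-- One step of the face tracing: traverse the edge, then turn to the next edge of the face. -/
def next (f : Φ.Flag) : Φ.Flag := Φ.turn (Φ.along f)

/-- The vertex of a flag. -/
def vert (f : Φ.Flag) : V := f.1.fst

/-- The faces. A face with an edge on its boundary is a class of flags under the equivalence
relation generated by `along` and `turn`; the component of an isolated vertex is a sphere,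
with one face. -/
def Face : Type _ :=
  (Quot fun f g : Φ.Flag => g = Φ.along f ∨ g = Φ.turn f) ⊕ {v : V // ∀ w, ¬ G.Adj v w}

/-- The Euler characteristic `|V| - |E| + |F|` of the surface of the embedding. -/
noncomputable def eulerChar : ℤ :=
  (Nat.card V : ℤ) - (Nat.card G.edgeSet : ℤ) + (Nat.card Φ.Face : ℤ)

/-- The surface of the embedding is orientable: no closed walk reverses the orientation, i.e.
the product of the edge signatures along every closed walk is `1`. -/
def IsOrientable : Prop :=
  ∀ (v : V) (p : G.Walk v v), (p.darts.map Φ.sig).prod = 1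

/-- Every face is bounded by a 4-cycle: tracing the face from any flag visits four distinct
vertices and closes up after four steps. The boundary of the face of an isolated vertex is not a
4-cycle, so there is no isolated vertex. -/
def IsQuadrangular : Prop :=
  (∀ f : Φ.Flag, Φ.next^[4] f = f ∧
    [Φ.vert f, Φ.vert (Φ.next f), Φ.vert (Φ.next^[2] f), Φ.vert (Φ.next^[3] f)].Nodup) ∧
  ∀ v : V, ∃ w, G.Adj v w

end CellularEmbedding

/-- The connected closed surfaces: `S h` is the orientable surface of genus `h ≥ 0`, and `N k` is
the nonorientable surface of genus `k ≥ 1`. -/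
inductive ClosedSurface : Type
  | S (h : ℕ)
  | N (k : ℕ)

namespace CellularEmbedding

variable {V : Type*} {G : SimpleGraph V} (Φ : CellularEmbedding G)

/-- The surface of the embedding is the given closed surface. As embeddings are cellular, the
surface is connected iff the graph is, and it is then determined by its orientability and its
Euler characteristic, which is `2 - 2h` for `S h` and `2 - k` for `N k`. -/
def IsOn : ClosedSurface → Prop
  | .S h => G.Connected ∧ Φ.IsOrientable ∧ Φ.eulerChar = 2 - 2 * (h : ℤ)
  | .N k => 1 ≤ k ∧ G.Connected ∧ ¬ Φ.IsOrientable ∧ Φ.eulerChar = 2 - (k : ℤ)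

/-- `Φ` is a minimal quadrangulation of `M`: it is a quadrangular embedding of a connected simple
graph on `M`, and no simple graph of smaller order has a quadrangular embedding on `M`. -/
def IsMinimalQuadrangulation (M : ClosedSurface) : Prop :=
  Φ.IsQuadrangular ∧ Φ.IsOn M ∧
    ∀ (n : ℕ) (H : SimpleGraph (Fin n)) (Ψ : CellularEmbedding H),
      n < Nat.card V → ¬ (Ψ.IsQuadrangular ∧ Ψ.IsOn M)

end CellularEmbedding

/-!
The Euler characteristic decides the minimality. A quadrangular embedding has half as many faces
as edges (each face has eight flags), so `2χ = 2n - |E|`, and `|E| ≤ n(n-1)/2` gives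
`4χ ≥ n(5 - n)`. For the surfaces in question this fails for all `n < 8ℓ`, so it suffices to embed `G[K_4]`
quadrangularly, both orientably and nonorientably.

As the deleted edges have fewer than `ℓ` endpoints, the vertices of `G` can be paired such that
each pair contains a vertex adjacent to all others; in particular, `G` has a perfect matching. The
edges of `G[K_4]` are distributed over blocks, one for each edge `uw` of `G`. If `uw` is not in
the matching, its block is the `K_{4,4}` on the copies of `u` and of `w`, embedded in the torus.
If `uw` is in the matching, its block is the `K_8` on these copies, embedded quadrangularly in the
orientable surface of genus `4` or in the nonorientable surface of genus `8`. All blocks are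
symmetric in `u` and `w`, and each has faces with opposite corners at the copies `0`, `1` of `u`,
at the copies `2`, `3` of `u`, and likewise for `w`; these four faces are distinct.

The blocks at `u` are merged along these faces: the rotation at each copy of `u` is cut open at
the corner in its special face, and the pieces of all blocks at `u` are joined in a cyclic order
of the neighbours of `u`, which is reversed at the copies `1` and `3`. Tracing a special face, the
passage through one of its two cut corners leads to the next block and the passage through the
other one leads back, so the faces remain quadrangles (`vQuad_comp`, `Gluing.vQuad_rot`). The
properties of the blocks are finite checks (`Block.Good`).

Flags are handled as triples `(x, y, ε)` of two vertices and a sign, and rotations as permutations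
`T x` of the vertices that are cyclic on the neighbours of `x` (`CellularEmbedding.ofTargets`).
-/

/-! ### Rotation systems given by permutations of the vertices -/

/-- A side of an edge near one end, written with vertices instead of darts: the triple
`(x, y, ε)` stands for the flag `(d, ε)` on the dart `d` from `x` to `y`. Triples with `x`, `y` not
adjacent are allowed, and are never reached from flags. -/
abbrev VFlag (W : Type*) : Type _ := W × W × ℤˣ

/-- Face tracing on triples `(x, y, ε)`, for the rotation that sends the dart from `x` to `y` to
the dart from `x` to `T x y`, and for the signature `s`. -/
def vNext {W : Type*} (T : W → Equiv.Perm W) (s : W → W → ℤˣ) (f : VFlag W) : VFlag W :=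
  (f.2.1, if f.2.2 * s f.1 f.2.1 = 1 then (T f.2.1).symm f.1 else T f.2.1 f.1,
    f.2.2 * s f.1 f.2.1)

/-- The tracing started at `f` closes up after four steps and visits four distinct vertices. -/
def VQuad {W : Type*} (N : VFlag W → VFlag W) (f : VFlag W) : Prop :=
  N^[4] f = f ∧ [f.1, (N f).1, (N^[2] f).1, (N^[3] f).1].Nodup

namespace CellularEmbedding

section Flags

variable {V : Type*} {G : SimpleGraph V} (Φ : CellularEmbedding G)

theorem along_along (f : Φ.Flag) : Φ.along (Φ.along f) = f := by
  obtain ⟨d, ε⟩ := f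
  rcases Int.units_eq_one_or (Φ.sig d) with h | h <;> simp [along, Φ.sig_symm, h]

theorem turn_turn (f : Φ.Flag) : Φ.turn (Φ.turn f) = f := by
  obtain ⟨d, ε⟩ := f
  simp [turn, ← Equiv.Perm.mul_apply]

theorem vert_turn (f : Φ.Flag) : Φ.vert (Φ.turn f) = Φ.vert f := by
  obtain ⟨d, ε⟩ := f
  rcases Int.units_eq_one_or ε with rfl | rfl
  · simpa [turn, vert] using Φ.rot_fst d
  · have := Φ.rot_fst (Φ.rot⁻¹ d)
    simpa [turn, vert] using this.symm

end Flags

section OfTargets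

variable {W : Type*} (H : SimpleGraph W)

variable {H} in
/-- The permutation of the darts that moves the end of a dart starting at `x` by `T x`. -/
def dartPerm (T : W → Equiv.Perm W) (hT : ∀ x, (T x).IsCycleOn (H.neighborSet x)) :
    Equiv.Perm H.Dart where
  toFun d := ⟨(d.fst, T d.fst d.snd), (hT d.fst).1.mapsTo d.adj⟩
  invFun d := ⟨(d.fst, (T d.fst).symm d.snd),
    ((hT d.fst).apply_mem_iff (x := (T d.fst).symm d.snd)).1 (by simp)⟩
  left_inv d := by ext <;> simp
  right_inv d := by ext <;> simp

variable {H} in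
theorem dartPerm_pow_apply (T : W → Equiv.Perm W) (hT : ∀ x, (T x).IsCycleOn (H.neighborSet x))
    (n : ℕ) (d : H.Dart) : ((dartPerm T hT ^ n) d).toProd = (d.fst, (T d.fst ^ n) d.snd) := by
  induction n with
  | zero => rfl
  | succ n ih =>
    rw [pow_succ', pow_succ', Equiv.Perm.mul_apply, Equiv.Perm.mul_apply]
    change (_, T _ _) = _
    rw [ih]

/-- The cellular embedding whose rotation at `x` permutes the neighbours of `x` by `T x`. -/
def ofTargets (T : W → Equiv.Perm W) (hT : ∀ x, (T x).IsCycleOn (H.neighborSet x))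
    (s : W → W → ℤˣ) (hs : ∀ x y, s x y = s y x) : CellularEmbedding H where
  rot := dartPerm T hT
  rot_fst _ := rfl
  rot_cyclic d d' h := by
    have hd' : d'.snd ∈ H.neighborSet d.fst := by rw [h]; exact d'.adj
    obtain ⟨n | n, hn⟩ := (hT d.fst).2 d.adj hd'
    · refine ⟨n, SimpleGraph.Dart.ext _ _ ?_⟩
      rw [zpow_natCast, dartPerm_pow_apply]
      exact Prod.ext h (by simpa using hn)
    · refine ⟨Int.negSucc n, ?_⟩
      rw [zpow_negSucc, Equiv.Perm.inv_eq_iff_eq] at hn ⊢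
      refine SimpleGraph.Dart.ext _ _ ?_
      rw [dartPerm_pow_apply, ← h, ← hn]
  sig d := s d.fst d.snd
  sig_symm d := hs _ _

variable {H} {T : W → Equiv.Perm W} {hT : ∀ x, (T x).IsCycleOn (H.neighborSet x)}
  {s : W → W → ℤˣ} {hs : ∀ x y, s x y = s y x}

/-- The triple of vertices and side that describes a flag. -/
def toVFlag (Φ : CellularEmbedding H) (f : Φ.Flag) : VFlag W := (f.1.fst, f.1.snd, f.2)

theorem toVFlag_injective (Φ : CellularEmbedding H) : Function.Injective Φ.toVFlag := by
  rintro ⟨⟨⟨a, b⟩, h⟩, e⟩ ⟨⟨⟨a', b'⟩, h'⟩, e'⟩ hh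
  simp only [toVFlag, Prod.mk.injEq] at hh
  obtain ⟨rfl, rfl, rfl⟩ := hh
  rfl

theorem toVFlag_next (f : (ofTargets H T hT s hs).Flag) :
    toVFlag _ ((ofTargets H T hT s hs).next f) = vNext T s (toVFlag _ f) := by
  obtain ⟨d, e⟩ := f
  refine Prod.ext ?_ (Prod.ext ?_ ?_)
  · exact (vert_turn _ _)
  · change (((ofTargets H T hT s hs).rot ^ ((-(e * s d.fst d.snd) : ℤˣ) : ℤ)) d.symm).snd = _
    rcases Int.units_eq_one_or (e * s d.fst d.snd) with h | h
    · rw [h]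
      simp only [Units.val_neg, Units.val_one, zpow_neg, zpow_one, vNext, toVFlag, h, if_true]
      rfl
    · rw [h]
      simp only [neg_neg, Units.val_one, zpow_one, vNext, toVFlag, h]
      rfl
  · simp [toVFlag, next, turn, along, vNext, ofTargets]

theorem toVFlag_iterate_next (n : ℕ) (f : (ofTargets H T hT s hs).Flag) :
    toVFlag _ ((ofTargets H T hT s hs).next^[n] f) = (vNext T s)^[n] (toVFlag _ f) := by
  induction n generalizing f with
  | zero => rfl
  | succ n ih => rw [Function.iterate_succ_apply, ih, toVFlag_next, Function.iterate_succ_apply]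

theorem isQuadrangular_ofTargets
    (h : ∀ x y ε, H.Adj x y → VQuad (vNext T s) (x, y, ε)) (h' : ∀ x, ∃ y, H.Adj x y) :
    (ofTargets H T hT s hs).IsQuadrangular := by
  refine ⟨fun f => ?_, h'⟩
  obtain ⟨h4, hn⟩ := h f.1.fst f.1.snd f.2 f.1.adj
  refine ⟨toVFlag_injective _ ?_, ?_⟩
  · rw [toVFlag_iterate_next]; exact h4
  · have e : ∀ n, (ofTargets H T hT s hs).vert ((ofTargets H T hT s hs).next^[n] f) =
      ((vNext T s)^[n] (f.1.fst, f.1.snd, f.2)).1 := fun n =>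
        congrArg Prod.fst (toVFlag_iterate_next n f)
    have e1 := e 1
    simp only [Function.iterate_one] at e1
    rw [e 2, e 3, e1]
    exact hn

end OfTargets

/-! ### Transport along a graph isomorphism -/

section Transport

variable {V W : Type*} {G : SimpleGraph V} {H : SimpleGraph W}

/-- The bijection of darts induced by a graph isomorphism. -/
def dartEquiv (e : G ≃g H) : G.Dart ≃ H.Dart where
  toFun d := ⟨(e d.fst, e d.snd), e.map_adj_iff.2 d.adj⟩
  invFun d := ⟨(e.symm d.fst, e.symm d.snd), e.symm.map_adj_iff.2 d.adj⟩
  left_inv d := by ext <;> simp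
  right_inv d := by ext <;> simp

/-- The image of an embedding under an isomorphism of graphs. -/
def transport (Φ : CellularEmbedding G) (e : G ≃g H) : CellularEmbedding H where
  rot := (dartEquiv e).permCongr Φ.rot
  rot_fst d := by
    have h := Φ.rot_fst ((dartEquiv e).symm d)
    change e (Φ.rot ((dartEquiv e).symm d)).fst = d.fst
    rw [h]
    exact e.apply_symm_apply _
  rot_cyclic d d' h := by
    have h1 : ((dartEquiv e).symm d).fst = ((dartEquiv e).symm d').fst := by
      change e.symm d.fst = e.symm d'.fst
      rw [h]
    obtain ⟨n, hn⟩ := Φ.rot_cyclic _ _ h1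
    refine ⟨n, ?_⟩
    have : (dartEquiv e).permCongr Φ.rot ^ n = (dartEquiv e).permCongr (Φ.rot ^ n) :=
      (map_zpow (dartEquiv e).permCongrHom Φ.rot n).symm
    rw [this, Equiv.permCongr_apply, hn, Equiv.apply_symm_apply]
  sig d := Φ.sig ((dartEquiv e).symm d)
  sig_symm d := Φ.sig_symm ((dartEquiv e).symm d)

theorem transport_next (Φ : CellularEmbedding G) (e : G ≃g H) (f : Φ.Flag) :
    (Φ.transport e).next (dartEquiv e f.1, f.2) =
      (dartEquiv e (Φ.next f).1, (Φ.next f).2) := by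
  obtain ⟨d, ε⟩ := f
  have hp : ∀ n : ℤ, (dartEquiv e).permCongr Φ.rot ^ n = (dartEquiv e).permCongr (Φ.rot ^ n) :=
    fun n => (map_zpow (dartEquiv e).permCongrHom Φ.rot n).symm
  have hs : (dartEquiv e d).symm = dartEquiv e d.symm := rfl
  simp only [next, turn, along, transport, hp, hs, Equiv.permCongr_apply, Equiv.symm_apply_apply]

theorem transport_iterate_next (Φ : CellularEmbedding G) (e : G ≃g H) (n : ℕ) (f : Φ.Flag) :
    (Φ.transport e).next^[n] (dartEquiv e f.1, f.2) =
      (dartEquiv e (Φ.next^[n] f).1, (Φ.next^[n] f).2) := by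
  induction n generalizing f with
  | zero => rfl
  | succ n ih => rw [Function.iterate_succ_apply, transport_next, ih, Function.iterate_succ_apply]

theorem IsQuadrangular.transport {Φ : CellularEmbedding G} (h : Φ.IsQuadrangular) (e : G ≃g H) :
    (Φ.transport e).IsQuadrangular := by
  constructor
  · intro f
    obtain ⟨f, rfl⟩ : ∃ g : Φ.Flag, f = (dartEquiv e g.1, g.2) :=
      ⟨((dartEquiv e).symm f.1, f.2), by simp⟩
    obtain ⟨h4, hn⟩ := h.1 f
    have hv : ∀ n, (Φ.transport e).vert ((Φ.transport e).next^[n] (dartEquiv e f.1, f.2)) =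
        e (Φ.vert (Φ.next^[n] f)) := fun n => by rw [transport_iterate_next]; rfl
    have h1 := hv 1
    simp only [Function.iterate_one] at h1
    refine ⟨by rw [transport_iterate_next, h4], ?_⟩
    rw [hv 2, hv 3, h1]
    exact hn.map e.injective
  · intro w
    obtain ⟨v, hv⟩ := h.2 (e.symm w)
    exact ⟨e v, by simpa using e.map_adj_iff.2 hv⟩

theorem transport_isOrientable_iff (Φ : CellularEmbedding G) (e : G ≃g H) :
    (Φ.transport e).IsOrientable ↔ Φ.IsOrientable := by
  have hG : ∀ {v w : V} (p : G.Walk v w),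
      ((p.map e.toHom).darts.map (Φ.transport e).sig).prod = (p.darts.map Φ.sig).prod := by
    intro v w p
    rw [SimpleGraph.Walk.darts_map, List.map_map]
    congr 1
    refine List.map_congr_left fun d _ => ?_
    exact congrArg Φ.sig ((dartEquiv e).symm_apply_apply d)
  have hH : ∀ {v w : W} (p : H.Walk v w),
      ((p.map e.symm.toHom).darts.map Φ.sig).prod = (p.darts.map (Φ.transport e).sig).prod := by
    intro v w p
    rw [SimpleGraph.Walk.darts_map, List.map_map]
    rfl
  exact ⟨fun h v p => (hG p).symm.trans (h _ _), fun h v p => (hH p).symm.trans (h _ _)⟩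

end Transport

/-! ### Counting the faces of a quadrangular embedding -/

section Counting

variable {V : Type*} {G : SimpleGraph V} (Φ : CellularEmbedding G)

theorem turn_snd (f : Φ.Flag) : (Φ.turn f).2 = -f.2 := rfl

theorem turn_ne (f : Φ.Flag) : Φ.turn f ≠ f := fun h => by
  have := congrArg Prod.snd h
  rw [turn_snd] at this
  rcases Int.units_eq_one_or f.2 with h | h <;> rw [h] at this <;> exact absurd this (by decide)

/-- The relation that generates the equivalence relation in the definition of faces. -/
def FaceRel (f g : Φ.Flag) : Prop := g = Φ.along f ∨ g = Φ.turn f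

variable {Φ}

/-- The eight flags of the quadrangular face of `f`. -/
def octet (Φ : CellularEmbedding G) (f : Φ.Flag) : Fin 4 × Bool → Φ.Flag :=
  fun p => if p.2 then Φ.turn (Φ.next^[p.1] f) else Φ.next^[p.1] f

theorem IsQuadrangular.vert_iterate_injective (h : Φ.IsQuadrangular) (f : Φ.Flag) :
    Function.Injective fun k : Fin 4 => Φ.vert (Φ.next^[k] f) := by
  have hn := (h.1 f).2
  have : [Φ.vert f, Φ.vert (Φ.next f), Φ.vert (Φ.next^[2] f), Φ.vert (Φ.next^[3] f)] =
      List.ofFn fun k : Fin 4 => Φ.vert (Φ.next^[k] f) := by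
    simp [List.ofFn_succ]
  rw [this] at hn
  exact List.nodup_ofFn.1 hn

theorem IsQuadrangular.octet_injective (h : Φ.IsQuadrangular) (f : Φ.Flag) :
    Function.Injective (Φ.octet f) := by
  have hv : ∀ p, Φ.vert (Φ.octet f p) = Φ.vert (Φ.next^[p.1] f) := by
    rintro ⟨k, b⟩
    cases b <;> simp [octet, vert_turn]
  rintro ⟨k, b⟩ ⟨l, c⟩ hkl
  have hk : k = l := h.vert_iterate_injective f (by
    have := congrArg Φ.vert hkl
    rwa [hv, hv] at this)
  subst hk
  cases b <;> cases c <;> simp [octet, Φ.turn_ne, (Φ.turn_ne _).symm] at hkl ⊢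

theorem IsQuadrangular.range_octet (h : Φ.IsQuadrangular) (f g : Φ.Flag) :
    g ∈ Set.range (Φ.octet f) ↔ Quot.mk Φ.FaceRel g = Quot.mk Φ.FaceRel f := by
  have q_turn : ∀ g, Quot.mk Φ.FaceRel (Φ.turn g) = Quot.mk Φ.FaceRel g := fun g =>
    (Quot.sound (r := Φ.FaceRel) (Or.inr rfl)).symm
  have q_along : ∀ g, Quot.mk Φ.FaceRel (Φ.along g) = Quot.mk Φ.FaceRel g := fun g =>
    (Quot.sound (r := Φ.FaceRel) (Or.inl rfl)).symm
  have q_iter : ∀ n g, Quot.mk Φ.FaceRel (Φ.next^[n] g) = Quot.mk Φ.FaceRel g := by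
    intro n
    induction n with
    | zero => intro g; rfl
    | succ n ih => intro g; rw [Function.iterate_succ_apply, ih, next, q_turn, q_along]
  constructor
  · rintro ⟨⟨k, b⟩, rfl⟩
    cases b <;> simp [octet, q_turn, q_iter]
  · intro hq
    have h4 := (h.1 f).1
    have hmem : ∀ (k : ℕ) (b : Bool), (if b then Φ.turn (Φ.next^[k] f) else Φ.next^[k] f) ∈
        Set.range (Φ.octet f) := by
      intro k b
      have hk : Φ.next^[k] f = Φ.next^[k % 4] f := by
        conv_lhs => rw [← Nat.mod_add_div k 4]
        rw [Function.iterate_add_apply, Function.iterate_mul]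
        congr 1
        exact Function.iterate_fixed h4 _
      exact ⟨(⟨k % 4, Nat.mod_lt _ (by norm_num)⟩, b), by simp only [octet]; rw [hk]⟩
    have hturn : ∀ g, g ∈ Set.range (Φ.octet f) → Φ.turn g ∈ Set.range (Φ.octet f) := by
      rintro _ ⟨⟨k, b⟩, rfl⟩
      cases b
      · exact hmem k true
      · simpa [octet, turn_turn] using hmem k false
    have halong : ∀ g, g ∈ Set.range (Φ.octet f) → Φ.along g ∈ Set.range (Φ.octet f) := by
      rintro _ ⟨⟨k, b⟩, rfl⟩
      cases b
      · have := hmem (k + 1) true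
        simpa [octet, Function.iterate_succ_apply', next, turn_turn] using this
      · have := hmem (k + 3) false
        have e : Φ.along (Φ.turn (Φ.next^[k] f)) = Φ.next^[k + 3] f := by
          have e4 : Φ.next^[4] (Φ.next^[k] f) = Φ.next^[k] f := by
            rw [← Function.iterate_add_apply, Nat.add_comm, Function.iterate_add_apply, h4]
          rw [← e4, Function.iterate_succ_apply', ← Function.iterate_add_apply, Nat.add_comm 3]
          simp [next, turn_turn, along_along]
        simpa [octet, e] using this
    have hiff : ∀ g g', Φ.FaceRel g g' →
        (g ∈ Set.range (Φ.octet f)) = (g' ∈ Set.range (Φ.octet f)) := by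
      rintro g g' (rfl | rfl)
      · exact propext ⟨halong g, fun h => by simpa [along_along] using halong _ h⟩
      · exact propext ⟨hturn g, fun h => by simpa [turn_turn] using hturn _ h⟩
    have := congrArg (Quot.lift (fun g => g ∈ Set.range (Φ.octet f)) hiff) hq
    have h0 : f ∈ Set.range (Φ.octet f) := hmem 0 false
    exact (Eq.symm this).mp h0

theorem card_flag [Finite V] : Nat.card (G.Dart × ℤˣ) = 4 * Nat.card G.edgeSet := by
  classical
  have := Fintype.ofFinite V
  rw [Nat.card_prod, Nat.card_eq_fintype_card, Nat.card_eq_fintype_card,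
    Nat.card_eq_fintype_card, G.dart_card_eq_twice_card_edges, ← SimpleGraph.edgeFinset_card]
  rw [show Fintype.card ℤˣ = 2 from rfl]
  ring

/-- A quadrangular embedding has half as many faces as edges. -/
theorem IsQuadrangular.two_mul_card_face [Finite V] (h : Φ.IsQuadrangular) :
    2 * Nat.card Φ.Face = Nat.card G.edgeSet := by
  classical
  have := Fintype.ofFinite V
  have hempty : IsEmpty {v : V // ∀ w, ¬ G.Adj v w} :=
    ⟨fun ⟨v, hv⟩ => (h.2 v).elim fun w hw => hv w hw⟩
  have hface : Nat.card Φ.Face = Nat.card (Quot Φ.FaceRel) :=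
    Nat.card_congr (Equiv.sumEmpty _ _)
  have hfib : ∀ q : Quot Φ.FaceRel, Nonempty ({g // Quot.mk Φ.FaceRel g = q} ≃ Fin 4 × Bool) := by
    intro q
    induction q using Quot.ind with
    | mk f =>
      refine ⟨(Equiv.subtypeEquivRight fun g => (h.range_octet f g).symm).trans ?_⟩
      exact (Equiv.ofInjective _ (h.octet_injective f)).symm
  have e : G.Dart × ℤˣ ≃ Quot Φ.FaceRel × (Fin 4 × Bool) :=
    (Equiv.sigmaFiberEquiv (Quot.mk Φ.FaceRel)).symm.trans
      ((Equiv.sigmaCongrRight fun q => (hfib q).some).trans (Equiv.sigmaEquivProd _ _))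
  have hc := Nat.card_congr e
  rw [card_flag, Nat.card_prod] at hc
  have h8 : Nat.card (Fin 4 × Bool) = 8 := by simp
  rw [h8] at hc
  omega

theorem IsQuadrangular.two_mul_eulerChar [Finite V] (h : Φ.IsQuadrangular) :
    2 * Φ.eulerChar = 2 * (Nat.card V : ℤ) - Nat.card G.edgeSet := by
  have := h.two_mul_card_face
  unfold eulerChar
  omega

/-- The Euler characteristic of a quadrangular embedding is bounded below by the order, because
a simple graph has few edges. -/
theorem IsQuadrangular.le_four_mul_eulerChar [Finite V] (h : Φ.IsQuadrangular) :
    (Nat.card V : ℤ) * (5 - Nat.card V) ≤ 4 * Φ.eulerChar := by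
  classical
  have := Fintype.ofFinite V
  have h2 := h.two_mul_eulerChar
  have he : Nat.card G.edgeSet ≤ (Nat.card V).choose 2 := by
    rw [Nat.card_eq_fintype_card, Nat.card_eq_fintype_card, ← SimpleGraph.edgeFinset_card]
    exact G.card_edgeFinset_le_card_choose_two
  have hch : ∀ n : ℕ, 2 * ((n.choose 2 : ℕ) : ℤ) = (n : ℤ) * (n - 1) := by
    rintro (_ | n)
    · simp
    · have h' := Nat.add_one_mul_choose_eq n 1
      simp only [Nat.choose_one_right, Nat.reduceAdd] at h'
      have : ((n : ℤ) + 1) * n = (n + 1).choose 2 * 2 := by exact_mod_cast h'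
      push_cast
      linarith
  have hch := hch (Nat.card V)
  have : ((Nat.card G.edgeSet : ℕ) : ℤ) ≤ ((Nat.card V).choose 2 : ℕ) := by exact_mod_cast he
  nlinarith

end Counting

end CellularEmbedding

/-! ### The building blocks -/

/-- The orientation sign of the copy number `i` of a vertex: the rotations at the copies with sign
`-1` run through the blocks of darts in the reverse order. -/
def copySign (i : Fin 4) : ℤˣ := if i.val % 2 = 0 then 1 else -1

/-- The copy opposite to `i` in the faces along which blocks are merged. -/
def partner (i : Fin 4) : Fin 4 := if i.val % 2 = 0 then i + 1 else i - 1

/-- The copy on the far side next to the cut corner of copy `i`: the first one of the block if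
`ε = -1`, and the last one if `ε = 1`. -/
def corner (i : Fin 4) (ε : ℤˣ) : Fin 4 := if copySign i * ε = -1 then 0 else 3

/-- A building block: the part of the embedding that belongs to one edge `uw` of `G`. It is an
embedded graph on the labels `(a, i) : Bool × Fin 4`, invariant under exchanging the two sides. In
`rot i` and `sig b i j`, the `Bool` says whether the other end of an edge lies on the far side.
The edges between two copies of the same vertex belong to the block if `inner` is true. -/
structure Block where
  inner : Bool
  rot : Fin 4 → Equiv.Perm (Bool × Fin 4)
  sig : Bool → Fin 4 → Fin 4 → ℤˣ

namespace Block

variable (P : Block)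

/-- Exchange the two sides if `a` is true. -/
def flip (a : Bool) : Equiv.Perm (Bool × Fin 4) where
  toFun y := (xor a y.1, y.2)
  invFun y := (xor a y.1, y.2)
  left_inv y := by simp
  right_inv y := by simp

/-- The rotation of the block at the label `x`. -/
def target (x : Bool × Fin 4) : Equiv.Perm (Bool × Fin 4) :=
  (flip x.1).trans ((P.rot x.2).trans (flip x.1))

/-- The signature of the block. -/
def sgn (x y : Bool × Fin 4) : ℤˣ := P.sig (xor x.1 y.1) x.2 y.2

/-- Adjacency in the block. -/
def Arc (x y : Bool × Fin 4) : Prop := x.1 ≠ y.1 ∨ (P.inner = true ∧ x.2 ≠ y.2)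

instance (x y : Bool × Fin 4) : Decidable (P.Arc x y) := inferInstanceAs (Decidable (_ ∨ _))

instance (W : Type*) [DecidableEq W] (N : VFlag W → VFlag W) (f : VFlag W) :
    Decidable (VQuad N f) := inferInstanceAs (Decidable (_ ∧ _))

/-- The flag at the cut corner of the label `(a, i)`, on the first dart of the block if `ε = -1`,
and on the last one if `ε = 1`. -/
def openFlag (a : Bool) (i : Fin 4) (ε : ℤˣ) : VFlag (Bool × Fin 4) :=
  ((a, i), (!a, corner i ε), ε)

/-- The flag `f` lies at a cut corner. -/
def IsOpen (f : VFlag (Bool × Fin 4)) : Prop := f.2.1 = (!f.1.1, corner f.1.2 f.2.2)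

instance (f : VFlag (Bool × Fin 4)) : Decidable (IsOpen f) := inferInstanceAs (Decidable (_ = _))

/-- A block is good if it is a quadrangular embedding in which the rotation at each label is one
cycle, and in which the cut corners of each label `i` and its partner lie in a common face, as
opposite corners, while the other two corners of this face are not cut. -/
structure Good : Prop where
  arc_rot : ∀ i y, P.Arc (false, i) (P.rot i y) ↔ P.Arc (false, i) y
  rot_fst : P.inner = false → ∀ i y, (P.rot i y).1 = y.1
  cyclic : ∀ i y, P.Arc (false, i) y → ∃ k : Fin 7, (P.rot i)^[k] (true, corner i (-1)) = y
  rot_last : ∀ i, P.rot i (true, corner i 1) = (true, corner i (-1))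
  sig_symm : ∀ b i j, P.sig b i j = P.sig b j i
  quad : ∀ x y ε, P.Arc x y → VQuad (vNext P.target P.sgn) (x, y, ε)
  next_openFlag : ∀ a i ε, ¬ IsOpen (vNext P.target P.sgn (openFlag a i ε))
  next_next_openFlag : ∀ a i ε, vNext P.target P.sgn (vNext P.target P.sgn (openFlag a i ε)) =
    openFlag a (partner i) ε

/-- The quadrangular embedding of `K_{4,4}` in the torus: the copies on the far side are visited
in the cyclic order `0, 1, 2, 3`, or its reverse. -/
def torus : Block where
  inner := false
  rot i := ⟨fun y => (y.1, if i.val % 2 = 0 then y.2 + 1 else y.2 - 1),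
    fun y => (y.1, if i.val % 2 = 0 then y.2 - 1 else y.2 + 1),
    fun y => by by_cases h : i.val % 2 = 0 <;> simp [h],
    fun y => by by_cases h : i.val % 2 = 0 <;> simp [h]⟩
  sig _ _ _ := 1

theorem good_torus : torus.Good := by
  constructor <;> decide +kernel

/-- The label with number `n`: `0`, …, `3` on the near side and `4`, …, `7` on the far side. -/
def lab (n : Fin 8) : Bool × Fin 4 := (decide (4 ≤ n.val), ⟨n.val % 4, Nat.mod_lt _ (by norm_num)⟩)

/-- The number of a label. -/
def num (y : Bool × Fin 4) : Fin 8 := ⟨(if y.1 then 4 else 0) + y.2.val, by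
  have := y.2.isLt
  split <;> omega⟩

theorem num_lab (n : Fin 8) : num (lab n) = n := by revert n; decide
theorem lab_num (y : Bool × Fin 4) : lab (num y) = y := by revert y; decide

/-- The numbering of the labels. -/
def labEquiv : Fin 8 ≃ Bool × Fin 4 := ⟨lab, num, num_lab, lab_num⟩

/-- The rotations at the near side of an orientable quadrangular embedding of `K_8`, each starting
with the first dart of the block. Those at the far side follow by symmetry. -/
def rotS : Fin 4 → Equiv.Perm (Fin 8) :=
  ![c[4, 5, 1, 3, 2, 6, 7], c[7, 3, 5, 6, 2, 0, 4], c[4, 5, 3, 1, 0, 6, 7], c[7, 6, 0, 2, 1, 5, 4]]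

/-- The rotations of a nonorientable quadrangular embedding of `K_8`. Its signature is `-1`
exactly on the edges between copies `i`, `j` of the same vertex with `i + j = 3`. -/
def rotN : Fin 4 → Equiv.Perm (Fin 8) :=
  ![c[4, 5, 2, 1, 3, 6, 7], c[7, 2, 0, 6, 5, 3, 4], c[4, 1, 3, 5, 6, 0, 7], c[7, 6, 1, 2, 0, 5, 4]]

/-- The quadrangulation of the orientable surface of genus `4` by `K_8`. -/
def orientableK8 : Block where
  inner := true
  rot i := labEquiv.permCongr (rotS i)
  sig _ _ _ := 1

/-- The quadrangulation of the nonorientable surface of genus `8` by `K_8`. -/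
def nonorientableK8 : Block where
  inner := true
  rot i := labEquiv.permCongr (rotN i)
  sig b i j := if b = false ∧ i.val + j.val = 3 then -1 else 1

theorem good_orientableK8 : orientableK8.Good := by
  constructor <;> decide +kernel

theorem good_nonorientableK8 : nonorientableK8.Good := by
  constructor <;> decide +kernel

end Block

/-! ### Gluing the blocks -/

/-- The combinatorial core of the gluing. Let `A` trace quadrangular faces, and let `B` move the
flags at cut corners. If every face with a cut corner has exactly two, at opposite corners, and
going around half a face and moving, twice, leads back to the start, then `B ∘ A` traces
quadrangles. -/
theorem vQuad_comp {W : Type*} {A B : VFlag W → VFlag W} {Arc Open : VFlag W → Prop}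
    (hA : ∀ f, Arc f → Arc (A f)) (hquad : ∀ f, Arc f → VQuad A f)
    (hBarc : ∀ f, Arc f → Open f → Arc (B f) ∧ Open (B f) ∧ (B f).1 = f.1)
    (hB : ∀ f, Arc f → ¬ Open f → B f = f)
    (hopen : ∀ f, Arc f → Open f → ¬ Open (A f) ∧ Open (A (A f)) ∧ B (A (A (B (A (A f))))) = f ∧
      [f.1, (A f).1, (A (A f)).1, (A (B (A (A f)))).1].Nodup)
    (f : VFlag W) (hf : Arc f) : VQuad (fun g => B (A g)) f := by
  have four : ∀ (N : VFlag W → VFlag W) (g : VFlag W), VQuad N g ↔ N (N (N (N g))) = g ∧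
      [g.1, (N g).1, (N (N g)).1, (N (N (N g))).1].Nodup := fun N g => Iff.rfl
  have h4 : ∀ f, Arc f → A (A (A (A f))) = f := fun f hf => ((four _ _).1 (hquad f hf)).1
  -- on faces with a cut corner, `B` acts at every other step
  have hclosed : ∀ g, Arc g → Open g → B (A g) = A g := fun g hg ho =>
    hB _ (hA _ hg) (hopen g hg ho).1
  rw [four]
  by_cases ho : Open f
  · obtain ⟨h1, h2, h3, h5⟩ := hopen f hf ho
    have h22 := hBarc _ (hA _ (hA _ hf)) h2
    simp only [hclosed f hf ho, hclosed _ h22.1 h22.2.1, h22.2.2]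
    exact ⟨h3, h5⟩
  · by_cases ho1 : Open (A f)
    · have hf1 := hA _ hf
      obtain ⟨h1, h2, h3, -⟩ := hopen _ hf1 ho1
      -- the start of the half face that precedes `A f`
      set k := A (A (A f)) with hk
      have hfk : A k = f := h4 f hf
      have hkarc : Arc k := hA _ (hA _ hf1)
      obtain ⟨hk1, hk2, hk3, hk4⟩ := hopen k hkarc h2
      have hB1 := hBarc _ hf1 ho1
      rw [hfk] at hk3 hk4
      have hstep := hclosed _ hB1.1 hB1.2.1
      simp only [hstep, hk3, hfk, hB f hf ho, hB1.2.2]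
      refine ⟨trivial, ?_⟩
      have hperm : [k.1, f.1, (A f).1, (A (B (A f))).1].Perm
          [f.1, (A f).1, (A (B (A f))).1, k.1] :=
        (List.perm_append_comm (l₁ := [k.1]) (l₂ := [f.1, (A f).1, (A (B (A f))).1]))
      exact hperm.nodup_iff.1 hk4
    · have ho2 : ¬ Open (A (A f)) := fun h => ho (by
        have := (hopen _ (hA _ (hA _ hf)) h).2.1
        rwa [h4 f hf] at this)
      have ho3 : ¬ Open (A (A (A f))) := fun h => ho1 (by
        have := (hopen _ (hA _ (hA _ (hA _ hf))) h).2.1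
        rwa [h4 f hf] at this)
      simp only [hB _ (hA _ hf) ho1, hB _ (hA _ (hA _ hf)) ho2,
        hB _ (hA _ (hA _ (hA _ hf))) ho3, h4 f hf, hB f hf ho]
      exact ⟨trivial, ((four _ _).1 (hquad f hf)).2⟩

/-- A perfect matching of `G`, a cyclic order of the neighbours of each vertex, and a building
block for the edges of the matching. -/
structure Gluing {V : Type*} (G : SimpleGraph V) where
  mate : V → V
  mate_mate : ∀ u, mate (mate u) = u
  adj_mate : ∀ u, G.Adj u (mate u)
  cyc : V → Equiv.Perm V
  isCycleOn_cyc : ∀ u, (cyc u).IsCycleOn (G.neighborSet u)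
  cyc_self : ∀ u, cyc u u = u
  block : Block
  good : block.Good
  inner : block.inner = true

namespace Gluing

variable {V : Type*} {G : SimpleGraph V} (D : Gluing G)

theorem mate_eq_iff {u w : V} : w = D.mate u ↔ u = D.mate w := by
  constructor
  · rintro rfl; exact (D.mate_mate u).symm
  · rintro rfl; exact (D.mate_mate w).symm

/-- The vertex of `G[K_4]` that a label of the block of the edge `uw` stands for. -/
def vertexOf (u w : V) (y : Bool × Fin 4) : V × Fin 4 := (if y.1 then w else u, y.2)

theorem vertexOf_flip (u w : V) (y : Bool × Fin 4) :
    vertexOf u w (Block.flip true y) = vertexOf w u y := by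
  obtain ⟨b, j⟩ := y
  cases b <;> rfl

variable [DecidableEq V]

/-- The block used for the edge `uw`. -/
def blockOf (u w : V) : Block := if w = D.mate u then D.block else Block.torus

theorem good_blockOf (u w : V) : (D.blockOf u w).Good := by
  unfold blockOf
  split
  · exact D.good
  · exact Block.good_torus

theorem blockOf_comm (u w : V) : D.blockOf u w = D.blockOf w u := by
  simp only [blockOf, D.mate_eq_iff (u := u) (w := w)]

theorem inner_blockOf {u w : V} : (D.blockOf u w).inner = true ↔ w = D.mate u := by
  unfold blockOf
  split <;> simp_all [D.inner, Block.torus]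

/-- The far end of the edge of `G` at `u` whose block contains the edges from copies of `u` to
copies of `v`. Edges between two copies of `u` belong to the block of the matching edge at `u`. -/
def far (u v : V) : V := if v = u then D.mate u else v

theorem far_ne (u v : V) : D.far u v ≠ u := by
  unfold far
  split
  · exact (D.adj_mate u).ne'
  · assumption

/-- The label of a neighbour of a copy of `u`. -/
def labelOf (u : V) (y : V × Fin 4) : Bool × Fin 4 := (decide (y.1 ≠ u), y.2)

/-- The labels of the block of `uw` that occur at copies of `u`. -/
def Occurs (u w : V) (l : Bool × Fin 4) : Prop := l.1 = true ∨ w = D.mate u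

theorem vertexOf_labelOf (u : V) (y : V × Fin 4) :
    vertexOf u (D.far u y.1) (labelOf u y) = y := by
  obtain ⟨v, j⟩ := y
  by_cases h : v = u <;> simp [vertexOf, labelOf, far, h]

theorem occurs_labelOf (u : V) (y : V × Fin 4) : D.Occurs u (D.far u y.1) (labelOf u y) := by
  obtain ⟨v, j⟩ := y
  by_cases h : v = u <;> simp [Occurs, labelOf, far, h]

theorem labelOf_vertexOf {u w : V} (h : w ≠ u) (l : Bool × Fin 4) :
    labelOf u (vertexOf u w l) = l := by
  obtain ⟨b, j⟩ := l
  cases b <;> simp [vertexOf, labelOf, h]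

theorem far_vertexOf {u w : V} (h : w ≠ u) {l : Bool × Fin 4} (hl : D.Occurs u w l) :
    D.far u (vertexOf u w l).1 = w := by
  obtain ⟨b, j⟩ := l
  cases b
  · have : w = D.mate u := by simpa [Occurs] using hl
    simp [vertexOf, far, this]
  · simp [vertexOf, far, h]

/-- Apply a function of the labels inside each block at a copy of `u`. -/
def blockwise (u : V) (S : V → Bool × Fin 4 → Bool × Fin 4) (y : V × Fin 4) : V × Fin 4 :=
  vertexOf u (D.far u y.1) (S (D.far u y.1) (labelOf u y))

theorem blockwise_vertexOf {u w : V} (h : w ≠ u) (S : V → Bool × Fin 4 → Bool × Fin 4)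
    {l : Bool × Fin 4} (hl : D.Occurs u w l) :
    D.blockwise u S (vertexOf u w l) = vertexOf u w (S w l) := by
  rw [blockwise, D.far_vertexOf h hl, labelOf_vertexOf h]

theorem occurs_rot {u w : V} (i : Fin 4) {l : Bool × Fin 4} :
    D.Occurs u w ((D.blockOf u w).rot i l) ↔ D.Occurs u w l := by
  by_cases h : w = D.mate u
  · simp [Occurs, h]
  · have := (D.good_blockOf u w).rot_fst (by
      rw [← Bool.not_eq_true, D.inner_blockOf]; exact h) i l
    simp [Occurs, this]

theorem occurs_rot_symm {u w : V} (i : Fin 4) {l : Bool × Fin 4} :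
    D.Occurs u w (((D.blockOf u w).rot i).symm l) ↔ D.Occurs u w l := by
  rw [← D.occurs_rot i, Equiv.apply_symm_apply]

/-- The rotation in which the darts of each block at a vertex form a cycle of their own. -/
def innerRot (x : V × Fin 4) : Equiv.Perm (V × Fin 4) where
  toFun := D.blockwise x.1 fun w => (D.blockOf x.1 w).rot x.2
  invFun := D.blockwise x.1 fun w => ((D.blockOf x.1 w).rot x.2).symm
  left_inv y := by
    have h := D.occurs_labelOf x.1 y
    conv_lhs => rw [← D.vertexOf_labelOf x.1 y]
    rw [D.blockwise_vertexOf (D.far_ne _ _) _ h,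
      D.blockwise_vertexOf (D.far_ne _ _) _ ((D.occurs_rot _).2 h), Equiv.symm_apply_apply,
      D.vertexOf_labelOf]
  right_inv y := by
    have h := D.occurs_labelOf x.1 y
    conv_lhs => rw [← D.vertexOf_labelOf x.1 y]
    rw [D.blockwise_vertexOf (D.far_ne _ _) _ h,
      D.blockwise_vertexOf (D.far_ne _ _) _ ((D.occurs_rot_symm _).2 h), Equiv.apply_symm_apply,
      D.vertexOf_labelOf]

/-- The signature: that of the block of an edge. -/
def sgn (x y : V × Fin 4) : ℤˣ :=
  (D.blockOf x.1 (D.far x.1 y.1)).sig (decide (y.1 ≠ x.1)) x.2 y.2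

theorem sgn_comm (x y : V × Fin 4) : D.sgn x y = D.sgn y x := by
  obtain ⟨u, i⟩ := x
  obtain ⟨v, j⟩ := y
  by_cases h : v = u
  · subst h
    exact (D.good_blockOf _ _).sig_symm _ _ _
  · have h' : u ≠ v := Ne.symm h
    simp only [sgn, far, h, h', if_false, ne_eq, not_false_eq_true]
    rw [D.blockOf_comm]
    exact (D.good_blockOf _ _).sig_symm _ _ _

/-- The rotation that permutes the first darts of the blocks at a vertex. -/
def shift (x : V × Fin 4) : Equiv.Perm (V × Fin 4) where
  toFun y := (if y.2 = corner x.2 (-1) then (D.cyc x.1 ^ (copySign x.2 : ℤ)) y.1 else y.1, y.2)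
  invFun y := (if y.2 = corner x.2 (-1) then (D.cyc x.1 ^ (-(copySign x.2 : ℤ))) y.1 else y.1, y.2)
  left_inv y := by
    by_cases h : y.2 = corner x.2 (-1)
    · simp only [h, if_true]
      rw [← Equiv.Perm.mul_apply, ← zpow_add, neg_add_cancel, zpow_zero, ← h]
      rfl
    · simp [h]
  right_inv y := by
    by_cases h : y.2 = corner x.2 (-1)
    · simp only [h, if_true]
      rw [← Equiv.Perm.mul_apply, ← zpow_add, add_neg_cancel, zpow_zero, ← h]
      rfl
    · simp [h]

/-- The glued rotation: the cycles of the blocks at a vertex are cut open and joined to one cycle,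
in the cyclic order of the neighbours, which is reversed at the copies of sign `-1`. -/
def rot (x : V × Fin 4) : Equiv.Perm (V × Fin 4) := (D.innerRot x).trans (D.shift x)

/-- The embedding of a flag of a block. -/
def flagOf (u w : V) (f : VFlag (Bool × Fin 4)) : VFlag (V × Fin 4) :=
  (vertexOf u w f.1, vertexOf u w f.2.1, f.2.2)

theorem occurs_of_arc {u w : V} {i : Fin 4} {y : Bool × Fin 4}
    (h : (D.blockOf u w).Arc (false, i) y) : D.Occurs u w y := by
  obtain ⟨b, j⟩ := y
  rcases h with h | h
  · left; cases b <;> simp_all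
  · exact Or.inr (D.inner_blockOf.1 h.1)

theorem innerRot_vertexOf {u w : V} (h : w ≠ u) {x y : Bool × Fin 4}
    (hxy : (D.blockOf u w).Arc x y) :
    D.innerRot (vertexOf u w x) (vertexOf u w y) = vertexOf u w ((D.blockOf u w).target x y) := by
  obtain ⟨a, i⟩ := x
  cases a
  · have : (D.blockOf u w).target (false, i) y = (D.blockOf u w).rot i y := by
      simp [Block.target, Block.flip]
    rw [this]
    exact D.blockwise_vertexOf h (fun w => (D.blockOf u w).rot i) (D.occurs_of_arc hxy)
  · have hy : vertexOf u w y = vertexOf w u (Block.flip true y) := by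
      rw [← vertexOf_flip]
    have : vertexOf u w ((D.blockOf u w).target (true, i) y) =
        vertexOf w u ((D.blockOf w u).rot i (Block.flip true y)) := by
      rw [D.blockOf_comm w u, ← vertexOf_flip u w]
      rfl
    rw [hy, this]
    refine D.blockwise_vertexOf h.symm (fun v => (D.blockOf w v).rot i)
      (D.occurs_of_arc (i := i) ?_)
    rw [D.blockOf_comm w u]
    rcases hxy with hxy | hxy
    · left; simpa [Block.flip] using hxy
    · exact Or.inr hxy

theorem sgn_vertexOf {u w : V} (h : w ≠ u) {x y : Bool × Fin 4}
    (hxy : (D.blockOf u w).Arc x y) :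
    D.sgn (vertexOf u w x) (vertexOf u w y) = (D.blockOf u w).sgn x y := by
  have hc := D.blockOf_comm w u
  obtain ⟨a, i⟩ := x
  obtain ⟨b, j⟩ := y
  cases a <;> cases b
  · have : w = D.mate u := D.inner_blockOf.1 (hxy.resolve_left fun h => h rfl).1
    simp [sgn, vertexOf, Block.sgn, far, this]
  · simp [sgn, vertexOf, Block.sgn, far, h]
  · simp [sgn, vertexOf, Block.sgn, far, h.symm, hc]
  · have : w = D.mate u := D.inner_blockOf.1 (hxy.resolve_left fun h => h rfl).1
    have h' := D.mate_eq_iff.1 this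
    simp [sgn, vertexOf, Block.sgn, far, ← h', hc]

theorem arc_target {P : Block} (hP : P.Good) {x y : Bool × Fin 4} :
    P.Arc x (P.target x y) ↔ P.Arc x y := by
  obtain ⟨a, i⟩ := x
  obtain ⟨b, j⟩ := y
  have := hP.arc_rot i (xor a b, j)
  cases a <;> cases b <;> simpa [Block.Arc, Block.target, Block.flip] using this

theorem arc_target_symm {P : Block} (hP : P.Good) {x y : Bool × Fin 4} :
    P.Arc x ((P.target x).symm y) ↔ P.Arc x y := by
  rw [← arc_target hP, Equiv.apply_symm_apply]

theorem arc_symm {P : Block} {x y : Bool × Fin 4} (h : P.Arc x y) : P.Arc y x :=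
  h.imp Ne.symm fun h => ⟨h.1, h.2.symm⟩

theorem vNext_flagOf {u w : V} (h : w ≠ u) {f : VFlag (Bool × Fin 4)}
    (hf : (D.blockOf u w).Arc f.1 f.2.1) :
    vNext D.innerRot D.sgn (flagOf u w f) =
      flagOf u w (vNext (D.blockOf u w).target (D.blockOf u w).sgn f) := by
  have hf' := arc_symm hf
  have hs : (D.innerRot (vertexOf u w f.2.1)).symm (vertexOf u w f.1) =
      vertexOf u w (((D.blockOf u w).target f.2.1).symm f.1) := by
    rw [Equiv.symm_apply_eq, D.innerRot_vertexOf h ((arc_target_symm (D.good_blockOf u w)).2 hf'),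
      Equiv.apply_symm_apply]
  simp only [vNext, flagOf, D.sgn_vertexOf h hf, hs, D.innerRot_vertexOf h hf']
  split <;> rfl

theorem arc_vNext {P : Block} (hP : P.Good) {f : VFlag (Bool × Fin 4)} (hf : P.Arc f.1 f.2.1) :
    P.Arc (vNext P.target P.sgn f).1 (vNext P.target P.sgn f).2.1 := by
  unfold vNext
  split
  · exact (arc_target_symm hP).2 (arc_symm hf)
  · exact (arc_target hP).2 (arc_symm hf)

/-- The graph that is embedded. -/
abbrev graph (_ : Gluing G) : SimpleGraph (V × Fin 4) :=
  G.composition (⊤ : SimpleGraph (Fin 4))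

theorem adj_vertexOf {u w : V} (h : G.Adj u w) {x y : Bool × Fin 4}
    (hxy : (D.blockOf u w).Arc x y) : D.graph.Adj (vertexOf u w x) (vertexOf u w y) := by
  obtain ⟨a, i⟩ := x
  obtain ⟨b, j⟩ := y
  rcases hxy with hxy | ⟨-, hij⟩
  · left; cases a <;> cases b <;> simp_all [vertexOf, h.symm]
  · cases a <;> cases b
    · exact Or.inr ⟨rfl, hij⟩
    · exact Or.inl h
    · exact Or.inl h.symm
    · exact Or.inr ⟨rfl, hij⟩

/-- Every edge of the graph lies in a block. -/
theorem exists_block {u : V} {i : Fin 4} {y : V × Fin 4} (h : D.graph.Adj (u, i) y) :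
    ∃ w l, G.Adj u w ∧ (D.blockOf u w).Arc (false, i) l ∧ y = vertexOf u w l := by
  refine ⟨D.far u y.1, labelOf u y, ?_, ?_, (D.vertexOf_labelOf u y).symm⟩
  · unfold far
    split
    · exact D.adj_mate u
    · rename_i hne
      rcases h with h | h
      · exact h
      · exact absurd h.1.symm hne
  · by_cases hy : y.1 = u
    · right
      rcases h with h | h
      · exact absurd hy h.ne'
      · exact ⟨D.inner_blockOf.2 (by simp [far, hy]), h.2⟩
    · left; simp [labelOf, hy]

theorem exists_flagOf {f : VFlag (V × Fin 4)} (h : D.graph.Adj f.1 f.2.1) :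
    ∃ u w g, G.Adj u w ∧ (D.blockOf u w).Arc g.1 g.2.1 ∧ f = flagOf u w g := by
  obtain ⟨⟨u, i⟩, y, ε⟩ := f
  obtain ⟨w, l, h1, h2, h3⟩ := D.exists_block h
  exact ⟨u, w, ((false, i), l, ε), h1, h2, Prod.ext rfl (Prod.ext h3 rfl)⟩

theorem vertexOf_injective {u w : V} (h : w ≠ u) : Function.Injective (vertexOf u w) :=
  Function.LeftInverse.injective (g := labelOf u) (labelOf_vertexOf h)

theorem vQuad_innerRot (f : VFlag (V × Fin 4)) (h : D.graph.Adj f.1 f.2.1) :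
    VQuad (vNext D.innerRot D.sgn) f := by
  obtain ⟨u, w, g, huw, hg, rfl⟩ := D.exists_flagOf h
  have hP := D.good_blockOf u w
  set N := vNext (D.blockOf u w).target (D.blockOf u w).sgn with hN
  have hit : ∀ n, (vNext D.innerRot D.sgn)^[n] (flagOf u w g) = flagOf u w (N^[n] g) ∧
      (D.blockOf u w).Arc (N^[n] g).1 (N^[n] g).2.1 := by
    intro n
    induction n with
    | zero => exact ⟨rfl, hg⟩
    | succ n ih =>
      rw [Function.iterate_succ_apply', Function.iterate_succ_apply', ih.1,
        D.vNext_flagOf huw.ne' ih.2]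
      exact ⟨rfl, arc_vNext hP ih.2⟩
  obtain ⟨h4, hn⟩ := hP.quad g.1 g.2.1 g.2.2 hg
  have h1 := (hit 1).1
  simp only [Function.iterate_one] at h1
  refine ⟨by rw [(hit 4).1]; exact congrArg _ h4, ?_⟩
  rw [(hit 2).1, (hit 3).1, h1]
  exact hn.map (vertexOf_injective huw.ne')

theorem adj_vNext (f : VFlag (V × Fin 4)) (h : D.graph.Adj f.1 f.2.1) :
    D.graph.Adj (vNext D.innerRot D.sgn f).1 (vNext D.innerRot D.sgn f).2.1 := by
  obtain ⟨u, w, g, huw, hg, rfl⟩ := D.exists_flagOf h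
  rw [D.vNext_flagOf huw.ne' hg]
  exact D.adj_vertexOf huw (arc_vNext (D.good_blockOf u w) hg)

/-- The flag at the cut corner of the copy `i` of `u` in the block of `uv`. -/
def openFlag (u v : V) (i : Fin 4) (ε : ℤˣ) : VFlag (V × Fin 4) := ((u, i), (v, corner i ε), ε)

/-- The flag `f` lies at a cut corner. -/
def IsOpen (f : VFlag (V × Fin 4)) : Prop := f.1.1 ≠ f.2.1.1 ∧ f.2.1.2 = corner f.1.2 f.2.2

end Gluing

/-! ### The faces of the glued rotation -/

namespace Gluing

variable {V : Type*} {G : SimpleGraph V} (D : Gluing G)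

theorem copySign_partner (i : Fin 4) : copySign (partner i) = -copySign i := by
  revert i; decide

theorem partner_partner (i : Fin 4) : partner (partner i) = i := by revert i; decide

theorem corner_partner_ne (i : Fin 4) (ε : ℤˣ) : corner (partner i) ε ≠ corner i ε := by
  revert i ε; decide

theorem partner_ne (i : Fin 4) : partner i ≠ i := by revert i; decide

theorem shift_first (x : V × Fin 4) (v : V) : D.shift x (v, corner x.2 (-1)) =
    ((D.cyc x.1 ^ (copySign x.2 : ℤ)) v, corner x.2 (-1)) := by
  simp [shift]

theorem shift_symm_first (x : V × Fin 4) (v : V) : (D.shift x).symm (v, corner x.2 (-1)) =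
    ((D.cyc x.1 ^ (-(copySign x.2 : ℤ))) v, corner x.2 (-1)) := by
  simp [shift]

theorem shift_of_ne {x y : V × Fin 4} (h : y.2 ≠ corner x.2 (-1)) : D.shift x y = y := by
  simp [shift, h]

theorem zpow_cyc_self (u : V) (n : ℤ) : (D.cyc u ^ n) u = u :=
  Function.IsFixedPt.perm_zpow (D.cyc_self u) n

theorem adj_zpow_cyc {u v : V} (n : ℤ) : G.Adj u ((D.cyc u ^ n) v) ↔ G.Adj u v := by
  have h := (D.isCycleOn_cyc u).1.perm_zpow n
  refine ⟨fun hv => ?_, fun hv => h.mapsTo hv⟩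
  obtain ⟨w, hw, hwv⟩ := h.surjOn hv
  rwa [← (D.cyc u ^ n).injective hwv]

theorem shift_self {x y : V × Fin 4} (h : y.1 = x.1) : D.shift x y = y := by
  by_cases h' : y.2 = corner x.2 (-1)
  · have : y = (x.1, corner x.2 (-1)) := Prod.ext h h'
    rw [this, D.shift_first, D.zpow_cyc_self]
  · exact D.shift_of_ne h'

theorem eq_openFlag {f : VFlag (V × Fin 4)} (h : IsOpen f) :
    f = openFlag f.1.1 f.2.1.1 f.1.2 f.2.2 :=
  Prod.ext rfl (Prod.ext (Prod.ext rfl h.2) rfl)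

theorem isOpen_openFlag {u v : V} (h : G.Adj u v) (i : Fin 4) (ε : ℤˣ) :
    IsOpen (openFlag u v i ε) := ⟨h.ne, rfl⟩

theorem openFlag_eq_flagOf (u v : V) (i : Fin 4) (ε : ℤˣ) :
    openFlag u v i ε = flagOf u v (Block.openFlag false i ε) := rfl

theorem isOpen_of_isOpen_flagOf {u w : V} {f : VFlag (Bool × Fin 4)}
    (h : IsOpen (flagOf u w f)) : Block.IsOpen f := by
  obtain ⟨⟨a, i⟩, ⟨b, j⟩, ε⟩ := f
  obtain ⟨h1, h2⟩ := h
  have h2' : j = corner i ε := h2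
  subst h2'
  cases a <;> cases b <;> simp_all [flagOf, vertexOf, Block.IsOpen]

theorem arc_openFlag (P : Block) (i : Fin 4) (ε : ℤˣ) :
    P.Arc (Block.openFlag false i ε).1 (Block.openFlag false i ε).2.1 := Or.inl Bool.false_ne_true

theorem nodup_quadrangle {u v w : V} {i i' j j' : Fin 4} (hv : u ≠ v) (hw : u ≠ w) (hi : i ≠ i')
    (hj : j ≠ j') : [(u, i), (v, j), (u, i'), (w, j')].Nodup := by
  simp [hv, hw, hi, hj, hv.symm]

theorem adj_shift {x y : V × Fin 4} (h : D.graph.Adj x y) : D.graph.Adj x (D.shift x y) := by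
  by_cases h1 : y.2 = corner x.2 (-1)
  · rcases h with h | h
    · left
      rw [show y = (y.1, corner x.2 (-1)) from Prod.ext rfl h1, D.shift_first]
      exact (D.adj_zpow_cyc _).2 h
    · rw [D.shift_self h.1.symm]
      exact Or.inr h
  · rw [D.shift_of_ne h1]; exact h

variable [DecidableEq V]

/-- The effect of `shift` on flags: those at cut corners move to another block. -/
def flagShift (f : VFlag (V × Fin 4)) : VFlag (V × Fin 4) :=
  (f.1, if f.2.2 = 1 then (D.innerRot f.1).symm ((D.shift f.1).symm (D.innerRot f.1 f.2.1))
    else D.shift f.1 f.2.1, f.2.2)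

theorem vNext_rot (f : VFlag (V × Fin 4)) :
    vNext D.rot D.sgn f = D.flagShift (vNext D.innerRot D.sgn f) := by
  unfold vNext flagShift
  split <;> simp [*, rot]

theorem innerRot_last {u v : V} (h : v ≠ u) (i : Fin 4) :
    D.innerRot (u, i) (v, corner i 1) = (v, corner i (-1)) := by
  have e : ∀ j, (v, j) = vertexOf u v (true, j) := fun j => rfl
  have := D.blockwise_vertexOf h (fun w => (D.blockOf u w).rot i) (l := (true, corner i 1))
    (Or.inl rfl)
  rw [(D.good_blockOf u v).rot_last] at this
  exact this

theorem innerRot_symm_first {u v : V} (h : v ≠ u) (i : Fin 4) :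
    (D.innerRot (u, i)).symm (v, corner i (-1)) = (v, corner i 1) := by
  rw [Equiv.symm_apply_eq, D.innerRot_last h]

theorem flagShift_openFlag {u v : V} (h : G.Adj u v) (i : Fin 4) (ε : ℤˣ) :
    D.flagShift (openFlag u v i ε) =
      openFlag u ((D.cyc u ^ (-((ε * copySign i : ℤˣ) : ℤ))) v) i ε := by
  rcases Int.units_eq_one_or ε with rfl | rfl
  · have h1 := D.innerRot_last h.ne' i
    have h2 : (D.cyc u ^ (-(copySign i : ℤ))) v ≠ u := ((D.adj_zpow_cyc _).2 h).ne'
    have h3 := D.shift_symm_first (u, i) v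
    simp only [flagShift, openFlag, if_true, one_mul, h1]
    rw [h3, D.innerRot_symm_first h2]
  · have h3 := D.shift_first (u, i) v
    simp only [flagShift, openFlag, show ¬ ((-1 : ℤˣ) = 1) by decide, if_false, h3]
    simp

theorem flagShift_of_not_isOpen {f : VFlag (V × Fin 4)} (h : ¬ IsOpen f) : D.flagShift f = f := by
  obtain ⟨⟨u, i⟩, y, ε⟩ := f
  rcases Int.units_eq_one_or ε with rfl | rfl
  · have key : D.shift (u, i) (D.innerRot (u, i) y) = D.innerRot (u, i) y := by
      by_cases h1 : (D.innerRot (u, i) y).1 = u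
      · exact D.shift_self h1
      · refine D.shift_of_ne fun h2 => h ?_
        have : y = ((D.innerRot (u, i) y).1, corner i 1) := by
          rw [← D.innerRot_symm_first h1 i, Equiv.eq_symm_apply]
          exact Prod.ext rfl h2
        rw [this]
        exact ⟨Ne.symm h1, rfl⟩
    have key' := (D.shift (u, i)).symm_apply_eq.2 key.symm
    simp [flagShift, key']
  · have key : D.shift (u, i) y = y := by
      by_cases h1 : y.1 = u
      · exact D.shift_self h1
      · exact D.shift_of_ne fun h2 => h ⟨Ne.symm h1, h2⟩
    simp [flagShift, show ¬ ((-1 : ℤˣ) = 1) by decide, key]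

theorem not_isOpen_vNext {u v : V} (h : G.Adj u v) (i : Fin 4) (ε : ℤˣ) :
    ¬ IsOpen (vNext D.innerRot D.sgn (openFlag u v i ε)) := by
  rw [openFlag_eq_flagOf, D.vNext_flagOf h.ne' (arc_openFlag _ i ε)]
  exact fun ho => (D.good_blockOf u v).next_openFlag _ _ _ (isOpen_of_isOpen_flagOf ho)

theorem vNext_vNext_openFlag {u v : V} (h : G.Adj u v) (i : Fin 4) (ε : ℤˣ) :
    vNext D.innerRot D.sgn (vNext D.innerRot D.sgn (openFlag u v i ε)) =
      openFlag u v (partner i) ε := by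
  have hP := D.good_blockOf u v
  rw [openFlag_eq_flagOf, D.vNext_flagOf h.ne' (arc_openFlag _ i ε),
    D.vNext_flagOf h.ne' (arc_vNext hP (arc_openFlag _ i ε)), hP.next_next_openFlag]
  rfl

/-- Every face of the glued rotation is a quadrangle. -/
theorem vQuad_rot (f : VFlag (V × Fin 4)) (hf : D.graph.Adj f.1 f.2.1) :
    VQuad (vNext D.rot D.sgn) f := by
  have hN : vNext D.rot D.sgn = fun g => D.flagShift (vNext D.innerRot D.sgn g) :=
    funext D.vNext_rot
  rw [hN]
  have hadj : ∀ {u v : V} {i : Fin 4} {ε : ℤˣ},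
      D.graph.Adj (openFlag u v i ε).1 (openFlag u v i ε).2.1 → u ≠ v → G.Adj u v := by
    intro u v i ε h hne
    rcases h with h | h
    · exact h
    · exact absurd h.1 hne
  refine vQuad_comp (Arc := fun f => D.graph.Adj f.1 f.2.1) (Open := IsOpen) D.adj_vNext
    D.vQuad_innerRot ?_ (fun f _ ho => D.flagShift_of_not_isOpen ho) ?_ f hf
  · intro f hf ho
    rw [eq_openFlag ho] at hf ⊢
    have h := hadj hf ho.1
    rw [D.flagShift_openFlag h]
    have h' := (D.adj_zpow_cyc (-((f.2.2 * copySign f.1.2 : ℤˣ) : ℤ))).2 h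
    exact ⟨Or.inl h', isOpen_openFlag h' _ _, rfl⟩
  · intro f hf ho
    rw [eq_openFlag ho] at hf ⊢
    have h := hadj hf ho.1
    have h' := (D.adj_zpow_cyc (-((f.2.2 * copySign (partner f.1.2) : ℤˣ) : ℤ))).2 h
    refine ⟨D.not_isOpen_vNext h _ _, ?_, ?_, ?_⟩
    · rw [D.vNext_vNext_openFlag h]
      exact isOpen_openFlag h _ _
    · -- the two moves are in opposite directions of the cyclic order
      rw [D.vNext_vNext_openFlag h, D.flagShift_openFlag h, D.vNext_vNext_openFlag h',
        D.flagShift_openFlag h', partner_partner, ← Equiv.Perm.mul_apply, ← zpow_add,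
        copySign_partner]
      simp
    · rw [D.vNext_vNext_openFlag h, D.flagShift_openFlag h]
      exact nodup_quadrangle h.ne h'.ne (partner_ne _).symm (corner_partner_ne _ _).symm

/-! ### The glued embedding -/

theorem adj_innerRot {x y : V × Fin 4} (h : D.graph.Adj x y) :
    D.graph.Adj x (D.innerRot x y) := by
  obtain ⟨u, i⟩ := x
  obtain ⟨w, l, huw, hl, rfl⟩ := D.exists_block h
  have := D.innerRot_vertexOf huw.ne' hl
  rw [show ((u, i) : V × Fin 4) = vertexOf u w (false, i) from rfl, this]
  exact D.adj_vertexOf huw ((arc_target (D.good_blockOf u w)).2 hl)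

/-- Inside a block, all darts at a vertex are reached from the first one. -/
theorem sameCycle_first {u w : V} (h : w ≠ u) (i : Fin 4) {l : Bool × Fin 4}
    (hl : (D.blockOf u w).Arc (false, i) l) :
    (D.rot (u, i)).SameCycle (w, corner i (-1)) (vertexOf u w l) := by
  have hP := D.good_blockOf u w
  obtain ⟨k, hk⟩ := hP.cyclic i l hl
  rw [← hk]
  clear hk hl
  generalize (k : ℕ) = k
  have harc : ∀ k, (D.blockOf u w).Arc (false, i)
      (((D.blockOf u w).rot i)^[k] (true, corner i (-1))) := by
    intro k
    induction k with
    | zero => exact Or.inl Bool.false_ne_true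
    | succ k ih =>
      rw [Function.iterate_succ_apply']
      exact (hP.arc_rot i _).2 ih
  induction k with
  | zero => exact Equiv.Perm.SameCycle.refl _ _
  | succ k ih =>
    rw [Function.iterate_succ_apply']
    set l := ((D.blockOf u w).rot i)^[k] (true, corner i (-1)) with hl
    by_cases hfirst : (D.blockOf u w).rot i l = (true, corner i (-1))
    · rw [hfirst]
      exact Equiv.Perm.SameCycle.refl _ _
    · have hr : D.innerRot (u, i) (vertexOf u w l) = vertexOf u w ((D.blockOf u w).rot i l) :=
        D.blockwise_vertexOf h (fun v => (D.blockOf u v).rot i) (D.occurs_of_arc (harc k))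
      have hs : D.rot (u, i) (vertexOf u w l) = vertexOf u w ((D.blockOf u w).rot i l) := by
        change D.shift _ (D.innerRot _ _) = _
        rw [hr]
        generalize (D.blockOf u w).rot i l = l' at hfirst ⊢
        obtain ⟨b, j⟩ := l'
        cases b
        · exact D.shift_self rfl
        · refine D.shift_of_ne fun hj => hfirst ?_
          exact Prod.ext rfl hj
      rw [← hs, Equiv.Perm.sameCycle_apply_right]
      exact ih

theorem sameCycle_first_first {u v w : V} (hv : G.Adj u v) (hw : G.Adj u w) (i : Fin 4) :
    (D.rot (u, i)).SameCycle (v, corner i (-1)) (w, corner i (-1)) := by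
  -- the last dart of a block is followed by the first dart of the next block
  have hstep : ∀ v, G.Adj u v → (D.rot (u, i)).SameCycle (v, corner i (-1))
      ((D.cyc u ^ (copySign i : ℤ)) v, corner i (-1)) := by
    intro v hv
    have h1 := D.sameCycle_first hv.ne' i (l := (true, corner i 1))
      (Or.inl Bool.false_ne_true)
    refine h1.trans ?_
    have h2 : D.rot (u, i) (v, corner i 1) = ((D.cyc u ^ (copySign i : ℤ)) v, corner i (-1)) := by
      change D.shift _ (D.innerRot _ _) = _
      rw [D.innerRot_last hv.ne']
      exact D.shift_first (u, i) v
    rw [← h2, Equiv.Perm.sameCycle_apply_right]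
    exact Equiv.Perm.SameCycle.refl _ _
  have hcyc : ∀ v, G.Adj u v → (D.rot (u, i)).SameCycle (v, corner i (-1))
      (D.cyc u v, corner i (-1)) := by
    intro v hv
    rcases Int.units_eq_one_or (copySign i) with hi | hi
    · simpa [hi] using hstep v hv
    · have h1 : G.Adj u (D.cyc u v) := by simpa using (D.adj_zpow_cyc 1).2 hv
      have := hstep _ h1
      rw [hi] at this
      simpa using this.symm
  have hpow : ∀ n : ℕ, ∀ v, G.Adj u v → (D.rot (u, i)).SameCycle (v, corner i (-1))
      ((D.cyc u ^ n) v, corner i (-1)) := by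
    intro n
    induction n with
    | zero => intro v _; exact Equiv.Perm.SameCycle.refl _ _
    | succ n ih =>
      intro v hv
      rw [pow_succ', Equiv.Perm.mul_apply]
      exact (ih v hv).trans (hcyc _ (by simpa using (D.adj_zpow_cyc n).2 hv))
  obtain ⟨n | n, hn⟩ := (D.isCycleOn_cyc u).2 hv hw
  · have := hpow n v hv
    rwa [show (D.cyc u ^ n) v = w by simpa using hn] at this
  · rw [zpow_negSucc, Equiv.Perm.inv_eq_iff_eq] at hn
    have := hpow (n + 1) w hw
    rw [← hn] at this
    exact this.symm

theorem isCycleOn_rot [Finite V] (x : V × Fin 4) :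
    (D.rot x).IsCycleOn (D.graph.neighborSet x) := by
  constructor
  · have hm : Set.MapsTo (D.rot x) (D.graph.neighborSet x) (D.graph.neighborSet x) :=
      fun y hy => D.adj_shift (D.adj_innerRot hy)
    have hi := (D.rot x).injective.injOn (s := D.graph.neighborSet x)
    exact ((Set.toFinite _).injOn_iff_bijOn_of_mapsTo hm).1 hi
  · obtain ⟨u, i⟩ := x
    have key : ∀ y, D.graph.Adj (u, i) y → ∃ w, G.Adj u w ∧
        (D.rot (u, i)).SameCycle (w, corner i (-1)) y := by
      intro y hy
      obtain ⟨w, l, huw, hl, rfl⟩ := D.exists_block hy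
      exact ⟨w, huw, D.sameCycle_first huw.ne' i hl⟩
    intro y hy z hz
    obtain ⟨v, hv, hvy⟩ := key y hy
    obtain ⟨w, hw, hwz⟩ := key z hz
    exact (hvy.symm.trans (D.sameCycle_first_first hv hw i)).trans hwz

/-- The glued embedding. -/
def embedding [Finite V] : CellularEmbedding (G.composition (⊤ : SimpleGraph (Fin 4))) :=
  CellularEmbedding.ofTargets D.graph D.rot D.isCycleOn_rot D.sgn D.sgn_comm

theorem isQuadrangular_embedding [Finite V] : D.embedding.IsQuadrangular :=
  CellularEmbedding.isQuadrangular_ofTargets (fun _ _ _ h => D.vQuad_rot _ h)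
    fun x => ⟨(D.mate x.1, 0), Or.inl (D.adj_mate x.1)⟩

theorem isOrientable_embedding [Finite V] (h : D.block.sig = fun _ _ _ => 1) :
    D.embedding.IsOrientable := by
  intro v p
  refine List.prod_eq_one fun s hs => ?_
  obtain ⟨d, -, rfl⟩ := List.mem_map.1 hs
  change D.sgn _ _ = 1
  unfold sgn blockOf
  split
  · rw [h]
  · rfl

/-- The triangle on the copies `0`, `1`, `3` of `u` reverses the orientation. -/
theorem not_isOrientable_embedding [Finite V] [Nonempty V] (h : D.block = Block.nonorientableK8) :
    ¬ D.embedding.IsOrientable := by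
  intro ho
  obtain ⟨u⟩ := ‹Nonempty V›
  have a01 : D.graph.Adj (u, 0) (u, 1) := Or.inr ⟨rfl, by simp⟩
  have a13 : D.graph.Adj (u, 1) (u, 3) := Or.inr ⟨rfl, by simp⟩
  have a30 : D.graph.Adj (u, 3) (u, 0) := Or.inr ⟨rfl, by simp⟩
  have := ho (u, 0) (.cons a01 (.cons a13 (.cons a30 .nil)))
  have e : ∀ i j, D.sgn (u, i) (u, j) = if i.val + j.val = 3 then -1 else 1 := by
    intro i j
    simp [sgn, far, blockOf, h, Block.nonorientableK8]
  simp only [SimpleGraph.Walk.darts_cons, SimpleGraph.Walk.darts_nil, List.map_cons, List.map_nil]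
    at this
  change List.prod [D.sgn (u, 0) (u, 1), D.sgn (u, 1) (u, 3), D.sgn (u, 3) (u, 0)] = 1 at this
  rw [e, e, e] at this
  exact absurd this (by decide)

end Gluing

/-! ### Order and size of the composition -/

section Composition

variable {V : Type*} {G : SimpleGraph V}

theorem SimpleGraph.card_edgeSet_composition [Finite V] :
    Nat.card (G.composition (⊤ : SimpleGraph (Fin 4))).edgeSet =
      16 * Nat.card G.edgeSet + 6 * Nat.card V := by
  classical
  have := Fintype.ofFinite V
  set H := G.composition (⊤ : SimpleGraph (Fin 4)) with hH
  have hdeg : ∀ x : V × Fin 4, H.degree x = 4 * G.degree x.1 + 3 := by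
    intro x
    have : H.neighborFinset x = (G.neighborFinset x.1 ×ˢ Finset.univ) ∪
        ({x.1} ×ˢ (Finset.univ.erase x.2)) := by
      ext y
      obtain ⟨v, i⟩ := x
      obtain ⟨w, j⟩ := y
      simp only [hH, SimpleGraph.composition, SimpleGraph.mem_neighborFinset, SimpleGraph.top_adj,
        Finset.mem_union, Finset.mem_product, Finset.mem_univ, Finset.mem_singleton,
        Finset.mem_erase, and_true, ne_eq, eq_comm]
    rw [← SimpleGraph.card_neighborFinset_eq_degree, this, Finset.card_union_of_disjoint]
    · simp [Finset.card_product, mul_comm]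
    · rw [Finset.disjoint_left]
      intro y hy hy'
      simp only [Finset.mem_product, SimpleGraph.mem_neighborFinset, Finset.mem_singleton] at hy hy'
      exact hy.1.ne' hy'.1
  have h1 := H.sum_degrees_eq_twice_card_edges
  have h2 := G.sum_degrees_eq_twice_card_edges
  have h3 : ∑ x, H.degree x = ∑ v, 4 * (4 * G.degree v + 3) := by
    rw [Fintype.sum_prod_type]
    exact Finset.sum_congr rfl fun v _ => (Finset.sum_congr rfl fun i _ => hdeg (v, i)).trans
      ((Finset.sum_const (4 * G.degree v + 3)).trans (by simp))
  rw [← Finset.mul_sum, Finset.sum_add_distrib, ← Finset.mul_sum, h2, h1, Finset.sum_const,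
    Finset.card_univ, smul_eq_mul] at h3
  rw [Nat.card_eq_fintype_card, Nat.card_eq_fintype_card, Nat.card_eq_fintype_card,
    ← SimpleGraph.edgeFinset_card, ← SimpleGraph.edgeFinset_card]
  omega

theorem SimpleGraph.connected_composition {w : V} (h : ∀ v, v ≠ w → G.Adj w v) :
    (G.composition (⊤ : SimpleGraph (Fin 4))).Connected := by
  have key : ∀ x, (G.composition (⊤ : SimpleGraph (Fin 4))).Reachable (w, 0) x := by
    rintro ⟨v, i⟩
    by_cases hv : v = w
    · subst hv
      by_cases hi : i = 0
      · subst hi; exact SimpleGraph.Reachable.refl _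
      · exact SimpleGraph.Adj.reachable (Or.inr ⟨rfl, fun h => hi h.symm⟩)
    · exact SimpleGraph.Adj.reachable (Or.inl (h v hv))
  have : Nonempty (V × Fin 4) := ⟨(w, 0)⟩
  exact ⟨fun x y => (key x).symm.trans (key y)⟩

end Composition

/-! ### Complete graphs with few edges deleted -/

section DeleteEdges

variable {V : Type*}

/-- A set of edges has at most twice as many endpoints. -/
theorem exists_endpoints (s : Finset (Sym2 V)) :
    ∃ A : Finset V, A.card ≤ 2 * s.card ∧ ∀ v w, s(v, w) ∈ s → v ∈ A ∧ w ∈ A := by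
  classical
  refine ⟨s.biUnion fun z => z.toFinset, ?_, fun v w h => ?_⟩
  · rw [mul_comm]
    exact Finset.card_biUnion_le_card_mul _ _ _ fun z _ => by
      rw [Sym2.card_toFinset]; split <;> omega
  · exact ⟨Finset.mem_biUnion.2 ⟨_, h, by simp⟩, Finset.mem_biUnion.2 ⟨_, h, by simp⟩⟩

variable [Finite V]

/-- If few edges are deleted, the vertices can be paired so that each pair contains a vertex at
which no edge was deleted. -/
theorem exists_pairing (ℓ : ℕ) (hV : Nat.card V = 2 * ℓ) (A : Finset V) (hA : A.card ≤ ℓ) :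
    ∃ m : V → V, (∀ v, m (m v) = v) ∧ (∀ v, m v ≠ v) ∧ ∀ v, v ∉ A ∨ m v ∉ A := by
  classical
  have := Fintype.ofFinite V
  rw [Nat.card_eq_fintype_card] at hV
  obtain ⟨B, hAB, hB⟩ := Finset.exists_superset_card_eq hA (by omega)
  have hBc : Bᶜ.card = ℓ := by rw [Finset.card_compl]; omega
  let e : B ≃ (Bᶜ : Finset V) := Fintype.equivOfCardEq (by simp only [Fintype.card_coe, hB, hBc])
  refine ⟨fun v => if h : v ∈ B then e ⟨v, h⟩ else e.symm ⟨v, Finset.mem_compl.2 h⟩, ?_, ?_, ?_⟩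
  · intro v
    by_cases h : v ∈ B
    · have h' : (e ⟨v, h⟩ : V) ∉ B := Finset.mem_compl.1 (e ⟨v, h⟩).2
      simp [h, h']
    · have h' : (e.symm ⟨v, Finset.mem_compl.2 h⟩ : V) ∈ B := (e.symm _).2
      simp [h, h']
  · intro v hv
    by_cases h : v ∈ B
    · have h' : (e ⟨v, h⟩ : V) ∉ B := Finset.mem_compl.1 (e ⟨v, h⟩).2
      simp only [h, dif_pos] at hv
      rw [hv] at h'
      exact h' h
    · have h' : (e.symm ⟨v, Finset.mem_compl.2 h⟩ : V) ∈ B := (e.symm _).2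
      simp only [h, dif_neg, not_false_eq_true] at hv
      rw [hv] at h'
      exact h h'
  · intro v
    by_cases h : v ∈ B
    · right
      simp only [h, dif_pos]
      exact fun h' => Finset.mem_compl.1 (e ⟨v, h⟩).2 (hAB h')
    · exact Or.inl fun h' => h (hAB h')

theorem card_edgeSet_top (n : ℕ) (hV : Nat.card V = 2 * n) :
    Nat.card (⊤ : SimpleGraph V).edgeSet = n * (2 * n - 1) := by
  classical
  have := Fintype.ofFinite V
  rw [Nat.card_eq_fintype_card] at hV ⊢
  rw [← SimpleGraph.edgeFinset_card, SimpleGraph.card_edgeFinset_top_eq_card_choose_two, hV,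
    Nat.choose_two_right, mul_assoc, Nat.mul_div_cancel_left _ (by norm_num)]

/-- Deleting edges loses at most as many edges as are listed, and exactly as many if they are
all edges. -/
theorem card_edgeSet_deleteEdges (G : SimpleGraph V) (s : Finset (Sym2 V)) :
    Nat.card G.edgeSet ≤ Nat.card (G.deleteEdges (s : Set (Sym2 V))).edgeSet + s.card ∧
    ((s : Set (Sym2 V)) ⊆ G.edgeSet →
      Nat.card G.edgeSet = Nat.card (G.deleteEdges (s : Set (Sym2 V))).edgeSet + s.card) := by
  rw [SimpleGraph.edgeSet_deleteEdges, Nat.card_coe_set_eq, Nat.card_coe_set_eq,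
    ← Set.ncard_coe_finset s]
  refine ⟨Set.ncard_le_ncard_sdiff_add_ncard _ _ (Set.toFinite _), fun h => ?_⟩
  exact (Set.ncard_sdiff_add_ncard_of_subset h (Set.toFinite _)).symm

end DeleteEdges

/-! ### Minimality -/

namespace ClosedSurface

/-- The Euler characteristic. -/
def euler : ClosedSurface → ℤ
  | .S h => 2 - 2 * (h : ℤ)
  | .N k => 2 - (k : ℤ)

end ClosedSurface

namespace CellularEmbedding

variable {V : Type*} {G : SimpleGraph V} {Φ : CellularEmbedding G} {M : ClosedSurface}

theorem IsOn.eulerChar_eq (h : Φ.IsOn M) : Φ.eulerChar = M.euler := by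
  cases M with
  | S g => exact h.2.2
  | N k => exact h.2.2.2

/-- A surface of so small an Euler characteristic has no quadrangulation of order below `8ℓ`. -/
theorem IsQuadrangular.le_card [Finite V] {ℓ q : ℕ} (hq : 2 * q + 1 ≤ ℓ) (h : Φ.IsQuadrangular)
    (hM : Φ.IsOn M) (hχ : M.euler ≤ 10 * ℓ - 16 * ℓ ^ 2 + 8 * q) : 8 * ℓ ≤ Nat.card V := by
  by_contra! hn
  have h1 := h.le_four_mul_eulerChar
  rw [hM.eulerChar_eq] at h1
  have hq' : 2 * (q : ℤ) + 1 ≤ ℓ := by exact_mod_cast hq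
  obtain ⟨t, ht⟩ : ∃ t : ℕ, 8 * ℓ = Nat.card V + 1 + t := ⟨8 * ℓ - (Nat.card V + 1), by omega⟩
  have ht' : 8 * (ℓ : ℤ) = Nat.card V + 1 + t := by exact_mod_cast ht
  have hc : (Nat.card V : ℤ) = 8 * ℓ - 1 - t := by linarith
  have ht0 : (0 : ℤ) ≤ t := Int.natCast_nonneg t
  have hc0 : (0 : ℤ) ≤ Nat.card V := Int.natCast_nonneg _
  rw [hc] at h1 hc0
  nlinarith [mul_nonneg ht0 hc0]

theorem IsQuadrangular.isMinimalQuadrangulation {ℓ q : ℕ} (hq : 2 * q + 1 ≤ ℓ)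
    (h : Φ.IsQuadrangular) (hM : Φ.IsOn M) (hχ : M.euler ≤ 10 * ℓ - 16 * ℓ ^ 2 + 8 * q)
    (hV : Nat.card V = 8 * ℓ) : Φ.IsMinimalQuadrangulation M :=
  ⟨h, hM, fun n H Ψ hn hΨ => by
    have := hΨ.1.le_card hq hΨ.2 hχ
    rw [Nat.card_fin] at this
    omega⟩

/-- If `G` is a complete graph minus few edges, gluing along a perfect matching of `G` yields both
an orientable and a nonorientable quadrangular embedding of `G[K_4]`. -/
theorem exists_isQuadrangular [Finite V] {ℓ q : ℕ} (hq : 2 * q + 1 ≤ ℓ) (s : Finset (Sym2 V))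
    (hV : Nat.card V = 2 * ℓ) (hs : s.card ≤ q)
    (hG : G = (⊤ : SimpleGraph V).deleteEdges (s : Set (Sym2 V))) :
    (G.composition (⊤ : SimpleGraph (Fin 4))).Connected ∧
    (∃ Φ : CellularEmbedding (G.composition (⊤ : SimpleGraph (Fin 4))),
      Φ.IsQuadrangular ∧ Φ.IsOrientable) ∧
    ∃ Φ : CellularEmbedding (G.composition (⊤ : SimpleGraph (Fin 4))),
      Φ.IsQuadrangular ∧ ¬ Φ.IsOrientable := by
  classical
  have := Fintype.ofFinite V
  obtain ⟨A, hA, hsA⟩ := exists_endpoints s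
  have hadj : ∀ v w, v ≠ w → v ∉ A ∨ w ∉ A → G.Adj v w := by
    intro v w hvw hv
    rw [hG, SimpleGraph.deleteEdges_adj]
    exact ⟨hvw, fun h => by have := hsA v w h; tauto⟩
  obtain ⟨m, hmm, hmv, hmA⟩ := exists_pairing ℓ hV A (by omega)
  have hcyc : ∀ u, ∃ σ : Equiv.Perm V, σ.IsCycleOn (G.neighborSet u) ∧ σ u = u := by
    intro u
    obtain ⟨σ, h1, h2⟩ := (G.neighborFinset u).exists_cycleOn
    refine ⟨σ, by simpa using h1, ?_⟩
    by_contra hu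
    have := h2 (Equiv.Perm.mem_support.2 hu)
    simp at this
  choose σ hσ hσu using hcyc
  have hne : Nonempty V := by
    rw [← Fintype.card_pos_iff, ← Nat.card_eq_fintype_card]; omega
  obtain ⟨w, hw⟩ : ∃ w, w ∉ A := by
    obtain ⟨v⟩ := hne
    rcases hmA v with h | h
    · exact ⟨_, h⟩
    · exact ⟨_, h⟩
  refine ⟨SimpleGraph.connected_composition fun v hv => hadj w v hv.symm (Or.inl hw), ?_, ?_⟩
  · let D : Gluing G := ⟨m, hmm, fun u => hadj _ _ (hmv u).symm (hmA u), σ, hσ, hσu,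
      Block.orientableK8, Block.good_orientableK8, rfl⟩
    exact ⟨D.embedding, D.isQuadrangular_embedding, D.isOrientable_embedding rfl⟩
  · let D : Gluing G := ⟨m, hmm, fun u => hadj _ _ (hmv u).symm (hmA u), σ, hσ, hσu,
      Block.nonorientableK8, Block.good_nonorientableK8, rfl⟩
    exact ⟨D.embedding, D.isQuadrangular_embedding, D.not_isOrientable_embedding rfl⟩

theorem eulerChar_of_card [Finite V]
    {Φ : CellularEmbedding (G.composition (⊤ : SimpleGraph (Fin 4)))} (h : Φ.IsQuadrangular) :
    Φ.eulerChar = Nat.card V - 8 * Nat.card G.edgeSet := by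
  have h1 := h.two_mul_eulerChar
  rw [SimpleGraph.card_edgeSet_composition, Nat.card_prod, Nat.card_fin] at h1
  push_cast at h1
  linarith

end CellularEmbedding

theorem corollary5p3 (ℓ q : ℕ) (hℓ : 1 ≤ ℓ) (hq : (q : ℚ) ≤ ((ℓ : ℚ) - 1) / 2) :
    -- `G` is obtained from `K_{2ℓ}` by deleting at most `q` edges
    (∀ (V : Type*) [Finite V] (s : Finset (Sym2 V)) (G : SimpleGraph V),
      Nat.card V = 2 * ℓ → s.card ≤ q → G = (⊤ : SimpleGraph V).deleteEdges (s : Set (Sym2 V)) →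
      (∃ (h : ℕ) (Φ : CellularEmbedding (G.composition (⊤ : SimpleGraph (Fin 4)))),
        Φ.IsMinimalQuadrangulation (.S h)) ∧
      (∃ (k : ℕ) (Φ : CellularEmbedding (G.composition (⊤ : SimpleGraph (Fin 4)))),
        Φ.IsMinimalQuadrangulation (.N k))) ∧
    -- the surfaces with the stated genera have minimal quadrangulations, all of order `8ℓ`
    (∀ M ∈ ({.S (8 * ℓ ^ 2 - 5 * ℓ - 4 * q + 1),
        .N (16 * ℓ ^ 2 - 10 * ℓ - 8 * q + 2)} : Set ClosedSurface),
      (∃ (n : ℕ) (L : SimpleGraph (Fin n)) (Φ : CellularEmbedding L),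
        Φ.IsMinimalQuadrangulation M) ∧
      ∀ (V : Type*) [Finite V] (L : SimpleGraph V) (Φ : CellularEmbedding L),
        Φ.IsMinimalQuadrangulation M → Nat.card V = 8 * ℓ) := by
  have hq' : 2 * q + 1 ≤ ℓ := by
    have : (2 * q + 1 : ℚ) ≤ ℓ := by linarith
    exact_mod_cast this
  have hqz : 2 * (q : ℤ) + 1 ≤ ℓ := by exact_mod_cast hq'
  have htop : ((ℓ * (2 * ℓ - 1) : ℕ) : ℤ) = 2 * ℓ ^ 2 - ℓ := by
    push_cast [show 1 ≤ 2 * ℓ by omega]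
    ring
  constructor
  · intro V _ s G hV hs hG
    obtain ⟨hconn, ⟨Φ, hΦ, hor⟩, ⟨Ψ, hΨ, hnor⟩⟩ :=
      CellularEmbedding.exists_isQuadrangular hq' s hV hs hG
    have hcard : Nat.card (V × Fin 4) = 8 * ℓ := by
      rw [Nat.card_prod, Nat.card_fin, hV]; ring
    have hE := (card_edgeSet_deleteEdges (⊤ : SimpleGraph V) s).1
    rw [card_edgeSet_top ℓ hV, ← hG] at hE
    have hE' : (2 * (ℓ : ℤ) ^ 2 - ℓ) ≤ Nat.card G.edgeSet + q := by
      rw [← htop]; exact_mod_cast hE.trans (by omega)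
    have hχ := CellularEmbedding.eulerChar_of_card hΦ
    have hχ' := CellularEmbedding.eulerChar_of_card hΨ
    rw [hV] at hχ hχ'
    push_cast at hχ hχ'
    have hle : 2 * (ℓ : ℤ) - 8 * Nat.card G.edgeSet ≤ 10 * ℓ - 16 * ℓ ^ 2 + 8 * q := by linarith
    have hpos : 2 * (ℓ : ℤ) - 8 * Nat.card G.edgeSet ≤ 0 := by nlinarith
    constructor
    · obtain ⟨h, hh⟩ := Int.eq_ofNat_of_zero_le
        (show 0 ≤ 1 - ((ℓ : ℤ) - 4 * Nat.card G.edgeSet) by linarith)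
      refine ⟨h, Φ, hΦ.isMinimalQuadrangulation hq' ⟨hconn, hor, by linarith⟩ ?_ hcard⟩
      exact le_trans (le_of_eq (by simp only [ClosedSurface.euler]; linarith)) hle
    · obtain ⟨k, hk⟩ := Int.eq_ofNat_of_zero_le
        (show 0 ≤ 2 - (2 * (ℓ : ℤ) - 8 * Nat.card G.edgeSet) by linarith)
      refine ⟨k, Ψ, hΨ.isMinimalQuadrangulation hq' ⟨by omega, hconn, hnor, by linarith⟩ ?_ hcard⟩
      exact le_trans (le_of_eq (by simp only [ClosedSurface.euler]; linarith)) hle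
  · intro M hM
    have hgS : ((8 * ℓ ^ 2 - 5 * ℓ - 4 * q + 1 : ℕ) : ℤ) = 8 * ℓ ^ 2 - 5 * ℓ - 4 * q + 1 := by
      have h1 : 5 * ℓ + 4 * q ≤ 8 * ℓ ^ 2 := by nlinarith
      rw [Nat.sub_sub]
      push_cast [h1]
      ring
    have hgN : ((16 * ℓ ^ 2 - 10 * ℓ - 8 * q + 2 : ℕ) : ℤ) = 16 * ℓ ^ 2 - 10 * ℓ - 8 * q + 2 := by
      have h1 : 10 * ℓ + 8 * q ≤ 16 * ℓ ^ 2 := by nlinarith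
      rw [Nat.sub_sub]
      push_cast [h1]
      ring
    have hMχ : M.euler = 10 * ℓ - 16 * ℓ ^ 2 + 8 * q := by
      rcases hM with rfl | rfl <;> simp only [ClosedSurface.euler]
      · rw [hgS]; ring
      · rw [hgN]; ring
    -- delete exactly `q` edges from the complete graph
    obtain ⟨s, hs, hsq⟩ : ∃ s ⊆ (⊤ : SimpleGraph (Fin (2 * ℓ))).edgeFinset, s.card = q := by
      refine Finset.exists_subset_card_eq ?_
      rw [SimpleGraph.edgeFinset_card, ← Nat.card_eq_fintype_card, card_edgeSet_top ℓ (by simp)]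
      have : (q : ℤ) ≤ (ℓ * (2 * ℓ - 1) : ℕ) := by rw [htop]; nlinarith
      exact_mod_cast this
    obtain ⟨G, hG⟩ : ∃ G, G =
      (⊤ : SimpleGraph (Fin (2 * ℓ))).deleteEdges (s : Set (Sym2 (Fin (2 * ℓ)))) := ⟨_, rfl⟩
    obtain ⟨hconn, ⟨Φ, hΦ, hor⟩, ⟨Ψ, hΨ, hnor⟩⟩ :=
      CellularEmbedding.exists_isQuadrangular hq' s (by simp) hsq.le hG
    have hE := (card_edgeSet_deleteEdges (⊤ : SimpleGraph (Fin (2 * ℓ))) s).2 (by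
      intro z hz
      exact SimpleGraph.mem_edgeFinset.1 (hs hz))
    rw [card_edgeSet_top ℓ (by simp), ← hG, hsq] at hE
    have hE' : (2 * (ℓ : ℤ) ^ 2 - ℓ) = Nat.card G.edgeSet + q := by
      rw [← htop]; exact_mod_cast hE
    let e : Fin (2 * ℓ) × Fin 4 ≃ Fin (8 * ℓ) := finProdFinEquiv.trans (finCongr (by ring))
    let L : SimpleGraph (Fin (8 * ℓ)) := (G.composition (⊤ : SimpleGraph (Fin 4))).map e.toEmbedding
    let i : G.composition (⊤ : SimpleGraph (Fin 4)) ≃g L := SimpleGraph.Iso.map e _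
    have hL : L.Connected := i.connected_iff.1 hconn
    have hLE : Nat.card L.edgeSet =
        Nat.card (G.composition (⊤ : SimpleGraph (Fin 4))).edgeSet :=
      (Nat.card_congr i.mapEdgeSet).symm
    rw [SimpleGraph.card_edgeSet_composition, Nat.card_fin] at hLE
    have hLχ : ∀ {Θ : CellularEmbedding L}, Θ.IsQuadrangular → Θ.eulerChar = M.euler := by
      intro Θ hΘ
      have := hΘ.two_mul_eulerChar
      rw [hLE, Nat.card_fin] at this
      push_cast at this
      rw [hMχ]
      linarith
    obtain ⟨Θ, hΘ⟩ : ∃ Θ : CellularEmbedding L, Θ.IsMinimalQuadrangulation M := by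
      rcases hM with rfl | rfl
      · have hq4 := hΦ.transport i
        exact ⟨_, hq4.isMinimalQuadrangulation hq'
          ⟨hL, (Φ.transport_isOrientable_iff i).2 hor, hLχ hq4⟩ hMχ.le (by simp)⟩
      · have hq4 := hΨ.transport i
        exact ⟨_, hq4.isMinimalQuadrangulation hq'
          ⟨by omega, hL, fun h => hnor ((Ψ.transport_isOrientable_iff i).1 h), hLχ hq4⟩ hMχ.le
          (by simp)⟩
    refine ⟨⟨_, L, Θ, hΘ⟩, fun W _ K Ξ hΞ => le_antisymm ?_ (hΞ.1.le_card hq' hΞ.2.1 hMχ.le)⟩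
    by_contra! hlt
    exact hΞ.2.2 _ L Θ hlt ⟨hΘ.1, hΘ.2.1⟩
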